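/- Let $d\ge 2$ and let $B\subset\mathbb R^d$ be a bounded convex set with nonempty interior, symmetric about the origin, whose boundary is a $C^\infty$ hypersurface with everywhere non-vanishing Gaussian curvature. Write $\|x\|_B=\inf\{t>0: x\in tB\}$ for the norm induced by $B$. Fix $c>0$. A set $P\subset\mathbb R^d$ of $n$ points is called well-distributed with constant $c$ if $|p-p'|\ge c$ for all distinct $p,p'\in P$ and every unit lattice cube $\prod_{i=1}^d[m_i,m_i+1)$, $m\in\mathbb Z^d$, that is contained in $[0,n^{1/d}]^d$ contains exactly one point of $P$. There is a constant $C>0$, depending only on $d$, $B$ and $c$, such that for every $n$, every set $P$ of $n$ points that is well-distributed with constant $c$, and every real $k$ with $1<k<n^{1/d}$, $$\#\left\{(p,p')\in P\times P:\ k\le\|p-p'\|_B\le k+n^{-\frac{d-1}{d(d+1)}}\right\}\le C\,n^{2-\frac{2}{d+1}}\left(\frac{k}{n^{1/d}}\right)^{\frac{d-1}{2}}.$$ In particular, for $d=2$: if $(n_j)$ is a sequence of positive integers, $P_j$ is a set of $n_j$ points that is well-distributed with constant $c$, and $1<k_j<n_j^{1/2}$ with $k_j=o(n_j^{1/2})$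 as $j\to\infty$, then the number of pairs $(p,p')\in P_j\times P_j$ with $k_j\le\|p-p'\|_B\le k_j+n_j^{-1/6}$ is $o(n_j^{4/3})$. -/

import Mathlib

open scoped ContDiff

noncomputable section

/-- `ρ` is a smooth defining function, on the open set `U`, of the boundary of `B`: inside `U` the
boundary is the zero set of `ρ`, and the differential of `ρ` does not vanish on it. -/
structure IsBoundaryDefiningFunction {d : ℕ} (B U : Set (EuclideanSpace ℝ (Fin d)))
    (ρ : EuclideanSpace ℝ (Fin d) → ℝ) : Prop where
  isOpen : IsOpen U
  smooth : ContDiffOn ℝ ∞ ρ U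
  mem_frontier_iff : ∀ x ∈ U, x ∈ frontier B ↔ ρ x = 0
  fderiv_ne_zero : ∀ x ∈ U, x ∈ frontier B → fderiv ℝ ρ x ≠ 0

/-- The boundary of `B` is a smooth (`C^∞`) embedded hypersurface. -/
def HasSmoothBoundary {d : ℕ} (B : Set (EuclideanSpace ℝ (Fin d))) : Prop :=
  ∀ x ∈ frontier B, ∃ (U : Set (EuclideanSpace ℝ (Fin d))) (ρ : EuclideanSpace ℝ (Fin d) → ℝ),
    x ∈ U ∧ IsBoundaryDefiningFunction B U ρ

/-- The tangent space at `x` of the level hypersurface of `ρ` through `x`. -/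
def levelTangentSpace {d : ℕ} (ρ : EuclideanSpace ℝ (Fin d) → ℝ) (x : EuclideanSpace ℝ (Fin d)) :
    Submodule ℝ (EuclideanSpace ℝ (Fin d)) :=
  LinearMap.ker (fderiv ℝ ρ x).toLinearMap

/-- The Gaussian curvature at `x` of the level hypersurface of `ρ` through `x`: the determinant, in
an orthonormal basis of the tangent space, of the second fundamental form
`(v, w) ↦ D²ρ(x)(v, w) / |∇ρ(x)|` (taken with respect to the unit normal `-∇ρ(x) / |∇ρ(x)|`). -/
def gaussianCurvature {d : ℕ} (ρ : EuclideanSpace ℝ (Fin d) → ℝ)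
    (x : EuclideanSpace ℝ (Fin d)) : ℝ :=
  Matrix.det (Matrix.of fun i j =>
    fderiv ℝ (fderiv ℝ ρ) x
        (stdOrthonormalBasis ℝ (levelTangentSpace ρ x) i : EuclideanSpace ℝ (Fin d))
        (stdOrthonormalBasis ℝ (levelTangentSpace ρ x) j : EuclideanSpace ℝ (Fin d))
      / ‖fderiv ℝ ρ x‖)

/-- The Gaussian curvature of the boundary of `B` vanishes nowhere. (At a given boundary point, any
two defining functions give the same curvature up to sign.) -/
def HasNonvanishingCurvature {d : ℕ} (B : Set (EuclideanSpace ℝ (Fin d))) : Prop :=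
  ∀ (U : Set (EuclideanSpace ℝ (Fin d))) (ρ : EuclideanSpace ℝ (Fin d) → ℝ),
    IsBoundaryDefiningFunction B U ρ → ∀ x ∈ U, x ∈ frontier B → gaussianCurvature ρ x ≠ 0

/-- A symmetric bounded convex set with interior points, with smooth boundary of nowhere vanishing
Gaussian curvature. -/
structure IsSmoothCurvedSymmetricBody {d : ℕ} (B : Set (EuclideanSpace ℝ (Fin d))) : Prop where
  convex : Convex ℝ B
  bounded : Bornology.IsBounded B
  interior_nonempty : (interior B).Nonempty
  symmetric : ∀ x ∈ B, -x ∈ B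
  smooth_boundary : HasSmoothBoundary B
  curvature : HasNonvanishingCurvature B

/-- The half-open unit lattice cube `∏ [mᵢ, mᵢ + 1)`. -/
def unitLatticeCube {d : ℕ} (m : Fin d → ℤ) : Set (EuclideanSpace ℝ (Fin d)) :=
  {x | ∀ i, (m i : ℝ) ≤ x i ∧ x i < (m i : ℝ) + 1}

/-- The cube `[0, L]^d`. -/
def bigCube (d : ℕ) (L : ℝ) : Set (EuclideanSpace ℝ (Fin d)) :=
  {x | ∀ i, 0 ≤ x i ∧ x i ≤ L}

/-- `P`, a set of `n` points in `ℝ^d`, is well-distributed with separation constant `c`. -/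
structure IsWellDistributed {d : ℕ} (c : ℝ) (n : ℕ) (P : Finset (EuclideanSpace ℝ (Fin d))) :
    Prop where
  card_eq : P.card = n
  separated : ∀ p ∈ P, ∀ p' ∈ P, p ≠ p' → c ≤ dist p p'
  existsUnique_mem_cube : ∀ m : Fin d → ℤ,
    unitLatticeCube m ⊆ bigCube d ((n : ℝ) ^ (1 / (d : ℝ))) → ∃! p, p ∈ P ∧ p ∈ unitLatticeCube m

/-- The number of ordered pairs `(p, p') ∈ P × P` with
`k ≤ ‖p - p'‖_B ≤ k + n^{-(d-1)/(d(d+1))}`, where `‖·‖_B` is the gauge of `B`. -/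
def distancePairCount {d : ℕ} (B : Set (EuclideanSpace ℝ (Fin d))) (n : ℕ)
    (P : Finset (EuclideanSpace ℝ (Fin d))) (k : ℝ) : ℕ :=
  Set.ncard {z : EuclideanSpace ℝ (Fin d) × EuclideanSpace ℝ (Fin d) |
    z.1 ∈ P ∧ z.2 ∈ P ∧ k ≤ gauge B (z.1 - z.2) ∧
      gauge B (z.1 - z.2) ≤ k + (n : ℝ) ^ (-(((d : ℝ) - 1) / ((d : ℝ) * ((d : ℝ) + 1))))}

end

/-! The proof is a double count over unnormalised outer normals θ. Let u(θ) be a point of the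
closure of B maximising ⟪θ, ·⟫, and write the width of the shell as kε². Nonvanishing curvature
makes B uniformly strongly convex (`exists_forall_le_inner_sub`). Hence a vector x of the shell
differs from k·u(θ) by an element of a slab S_θ of thickness about kε² along θ and radius about kε.
This holds for every θ in a box of volume (2ε)^(d-1) around the normal direction of x
(`exists_slab_cover`).

Integrating over θ, (number of pairs)·ε^(d-1) is at most a constant times the integral of the number
of pairs with p - p' ∈ k·u(θ) + S_θ. For fixed θ the translation can be removed at the cost of a
constant: correlations of a point set with a translate of itself are dominated by its
autocorrelation (`card_sub_sub_mem_slabBall_le`). This leaves, summed over all pairs, the volume of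
the bounded normals θ with p - p' ∈ 4S_θ. That volume is bounded on the diagonal, is O(kε² / |p -
p'|) when |p - p'| ≲ kε, and vanishes otherwise.

Separation bounds the sum of 1/|p - p'| over such p' by a multiple of (kε)^(d-1), so (number of
pairs)·ε^(d-1) ≲ n(1 + kε²(kε)^(d-1)). With kε² = n^(-(d-1)/(d(d+1))), the diagonal term gives
exactly the claimed bound, and the other term is no larger as long as k < n^(1/d). -/

/-! ### Second-order Taylor estimate with moving base point. -/

-- Strict differentiability of the derivative at `x₀` controls its increments between any two nearby
-- points, so one δ serves every base point `x` with the Hessian frozen at `x₀`. This uniformity is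
-- needed later, when the boundary points vary along a sequence.
open Set Filter Topology in
theorem exists_forall_ball_abs_taylor_two_le {E : Type*} [NormedAddCommGroup E] [NormedSpace ℝ E]
    {f : E → ℝ} {x₀ : E} (hf : ContDiffAt ℝ ∞ f x₀) {ε : ℝ} (hε : 0 < ε) :
    ∃ δ > 0, ∀ x ∈ Metric.ball x₀ δ, ∀ y ∈ Metric.ball x₀ δ,
      |f y - f x - fderiv ℝ f x (y - x) - 1 / 2 * fderiv ℝ (fderiv ℝ f) x₀ (y - x) (y - x)|
        ≤ ε * ‖y - x‖ ^ 2 := by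
  set H := fderiv ℝ (fderiv ℝ f) x₀ with hH
  have h1 : ContDiffAt ℝ 1 (fderiv ℝ f) x₀ := hf.fderiv_right (by norm_cast)
  have h2 : HasStrictFDerivAt (fderiv ℝ f) H x₀ := h1.hasStrictFDerivAt (by norm_num)
  have h3 := h2.isLittleO.def hε
  rw [nhds_prod_eq] at h3
  obtain ⟨t, ht, h3⟩ := (Filter.eventually_prod_self_iff (r := fun y z =>
    ‖fderiv ℝ f y - fderiv ℝ f z - H (y - z)‖ ≤ ε * ‖y - z‖)).1 h3
  have h4 : ∀ᶠ x in 𝓝 x₀, DifferentiableAt ℝ f x := by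
    have : ∀ᶠ x in 𝓝 x₀, ContDiffAt ℝ 1 f x :=
      (hf.of_le (by norm_cast)).eventually (by norm_cast)
    filter_upwards [this] with x hx using hx.differentiableAt (by norm_num)
  obtain ⟨δ, hδ, hball⟩ := Metric.mem_nhds_iff.1 (inter_mem ht h4)
  refine ⟨δ, hδ, fun x hx y hy => ?_⟩
  set w := y - x with hw
  have hmem : ∀ s ∈ Icc (0 : ℝ) 1, x + s • w ∈ Metric.ball x₀ δ := fun s hs =>
    (convex_ball x₀ δ).add_smul_sub_mem hx hy hs
  have hderiv : ∀ s ∈ Icc (0 : ℝ) 1, HasDerivWithinAt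
      (fun s : ℝ => f (x + s • w) - s * fderiv ℝ f x w - 1 / 2 * s ^ 2 * H w w)
      (fderiv ℝ f (x + s • w) w - fderiv ℝ f x w - s * H w w) (Icc 0 1) s := by
    intro s hs
    have hd : DifferentiableAt ℝ f (x + s • w) := (hball (hmem s hs)).2
    have hl : HasDerivAt (fun s : ℝ => x + s • w) w s := by
      simpa using ((hasDerivAt_id s).smul_const w).const_add x
    have e1 := hd.hasFDerivAt.comp_hasDerivAt s hl
    have e2 : HasDerivAt (fun s : ℝ => s * fderiv ℝ f x w) (fderiv ℝ f x w) s := by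
      simpa using (hasDerivAt_id s).mul_const (fderiv ℝ f x w)
    have e3 : HasDerivAt (fun s : ℝ => 1 / 2 * s ^ 2 * H w w) (s * H w w) s := by
      have := (((hasDerivAt_id s).pow 2).const_mul (1 / 2 : ℝ)).mul_const (H w w)
      refine this.congr_deriv ?_
      simp only [id, Nat.cast_ofNat]
      ring
    exact ((e1.sub e2).sub e3).hasDerivWithinAt
  have key := norm_image_sub_le_of_norm_deriv_le_segment_01' hderiv (C := ε * ‖w‖ ^ 2) (by
    intro s hs
    have hb := h3 (x + s • w) (hball (hmem s ⟨hs.1, hs.2.le⟩)).1 x (hball hx).1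
    have e : fderiv ℝ f (x + s • w) w - fderiv ℝ f x w - s * H w w
        = (fderiv ℝ f (x + s • w) - fderiv ℝ f x - H (x + s • w - x)) w := by
      simp
    rw [e]
    calc _ ≤ ‖fderiv ℝ f (x + s • w) - fderiv ℝ f x - H (x + s • w - x)‖ * ‖w‖ :=
          ContinuousLinearMap.le_opNorm _ _
      _ ≤ (ε * ‖x + s • w - x‖) * ‖w‖ := by gcongr
      _ = s * (ε * ‖w‖ ^ 2) := by
          rw [add_sub_cancel_left, norm_smul, Real.norm_of_nonneg hs.1]; ring
      _ ≤ 1 * (ε * ‖w‖ ^ 2) := by gcongr; exact hs.2.le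
      _ = _ := one_mul _)
  have e : x + (1 : ℝ) • w = y := by simp [hw]
  rw [e] at key
  simp only [zero_smul, add_zero, Real.norm_eq_abs] at key
  convert key using 2
  ring

/-! ### Defining functions at a supporting hyperplane. -/

section BoundaryDefiningFunction

open Set Filter Topology
open scoped RealInnerProductSpace

variable {d : ℕ} {B U : Set (EuclideanSpace ℝ (Fin d))} {ρ : EuclideanSpace ℝ (Fin d) → ℝ}
  {x θ v : EuclideanSpace ℝ (Fin d)}

namespace IsBoundaryDefiningFunction

theorem neg (h : IsBoundaryDefiningFunction B U ρ) :
    IsBoundaryDefiningFunction B U (fun x => -ρ x) where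
  isOpen := h.isOpen
  smooth := h.smooth.neg
  mem_frontier_iff x hx := by rw [h.mem_frontier_iff x hx, neg_eq_zero]
  fderiv_ne_zero x hx hxB := by
    rw [fderiv_fun_neg, neg_ne_zero]
    exact h.fderiv_ne_zero x hx hxB

theorem contDiffAt (h : IsBoundaryDefiningFunction B U ρ) (hx : x ∈ U) : ContDiffAt ℝ ∞ ρ x :=
  h.smooth.contDiffAt (h.isOpen.mem_nhds hx)

theorem differentiableAt (h : IsBoundaryDefiningFunction B U ρ) (hx : x ∈ U) :
    DifferentiableAt ℝ ρ x :=
  (h.contDiffAt hx).differentiableAt (by norm_cast)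

/-- A defining function comes with no prescribed sign inside or outside `B`. Sign changes along
segments are therefore the means of producing boundary points that contradict a support inequality.
-/
theorem exists_mem_segment_frontier (h : IsBoundaryDefiningFunction B U ρ)
    {a b : EuclideanSpace ℝ (Fin d)} (hab : segment ℝ a b ⊆ U) (ha : ρ a ≤ 0) (hb : 0 ≤ ρ b) :
    ∃ z ∈ segment ℝ a b, z ∈ frontier B := by
  obtain ⟨z, hz, hz0⟩ := (convex_segment (𝕜 := ℝ) a b).isPreconnected.intermediate_value
    (left_mem_segment ℝ a b) (right_mem_segment ℝ a b) (h.smooth.continuousOn.mono hab) ⟨ha, hb⟩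
  exact ⟨z, hz, (h.mem_frontier_iff z (hab hz)).2 hz0⟩

theorem eventually_pos (h : IsBoundaryDefiningFunction B U ρ) (hxU : x ∈ U) (hx : x ∈ frontier B)
    (hv : 0 < fderiv ℝ ρ x v) : ∀ᶠ t in 𝓝[>] (0 : ℝ), 0 < ρ (x + t • v) := by
  have hl : HasDerivAt (fun s : ℝ => x + s • v) v 0 := by
    simpa using ((hasDerivAt_id (0 : ℝ)).smul_const v).const_add x
  have hd : HasFDerivAt ρ (fderiv ℝ ρ x) (x + (0 : ℝ) • v) := by
    simpa using (h.differentiableAt hxU).hasFDerivAt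
  have := (hd.comp_hasDerivAt (0 : ℝ) hl).tendsto_slope_zero_right
  filter_upwards [this.eventually (lt_mem_nhds hv), self_mem_nhdsWithin] with t ht ht0
  have h0 : ρ x = 0 := (h.mem_frontier_iff x hxU).1 hx
  simp only [Function.comp, zero_add, zero_smul, add_zero, h0, sub_zero, smul_eq_mul] at ht
  exact (pos_iff_pos_of_mul_pos ht).1 (inv_pos.2 ht0)

theorem tendsto_line (w : EuclideanSpace ℝ (Fin d)) :
    Tendsto (fun t : ℝ => x + t • w) (𝓝[>] 0) (𝓝 x) := by
  have : Continuous (fun t : ℝ => x + t • w) := by fun_prop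
  simpa using (this.tendsto 0).mono_left nhdsWithin_le_nhds

/-- The differential of a defining function annihilates the directions of a supporting
hyperplane. -/
theorem fderiv_eq_zero_of_inner_eq_zero (h : IsBoundaryDefiningFunction B U ρ) (hxU : x ∈ U)
    (hx : x ∈ frontier B) (hθ : ‖θ‖ = 1) (hsupp : ∀ y ∈ frontier B, ⟪θ, y⟫ ≤ ⟪θ, x⟫)
    (hv : ⟪θ, v⟫ = 0) : fderiv ℝ ρ x v = 0 := by
  have main : ∀ v, ⟪θ, v⟫ = 0 → ¬ 0 < fderiv ℝ ρ x v := by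
    intro v hv hpos
    obtain ⟨η, hη, hη'⟩ : ∃ η > 0, η * |fderiv ℝ ρ x θ| < fderiv ℝ ρ x v := by
      refine ⟨fderiv ℝ ρ x v / (|fderiv ℝ ρ x θ| + 1), by positivity, ?_⟩
      rw [div_mul_eq_mul_div, div_lt_iff₀ (by positivity)]
      nlinarith [abs_nonneg (fderiv ℝ ρ x θ)]
    -- Tilting `v` and `-v` outward by a small `η • θ` keeps the signs of the derivative. So `ρ`
    -- changes sign on a segment lying strictly beyond the supporting hyperplane.
    have hb := abs_le.1 (le_refl |fderiv ℝ ρ x θ|)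
    have p1 : 0 < fderiv ℝ ρ x (v + η • θ) := by
      simp only [map_add, map_smul, smul_eq_mul]; nlinarith
    have p2 : 0 < fderiv ℝ (fun x => -ρ x) x (-v + η • θ) := by
      simp only [fderiv_fun_neg, map_add, map_smul, smul_eq_mul, map_neg,
        neg_apply]
      nlinarith
    obtain ⟨r, hr, hrU⟩ := Metric.isOpen_iff.1 h.isOpen x hxU
    have n1 := (tendsto_line (x := x) (v + η • θ)).eventually (Metric.ball_mem_nhds x hr)
    have n2 := (tendsto_line (x := x) (-v + η • θ)).eventually (Metric.ball_mem_nhds x hr)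
    obtain ⟨t, t1, t2, t3, t4, t5⟩ := ((h.eventually_pos hxU hx p1).and
      ((h.neg.eventually_pos hxU hx p2).and (n1.and (n2.and self_mem_nhdsWithin)))).exists
    obtain ⟨z, hz, hzB⟩ := h.exists_mem_segment_frontier
      (((convex_ball x r).segment_subset t4 t3).trans hrU) (by linarith) t1.le
    obtain ⟨a, b, ha, hb, hab, rfl⟩ := hz
    have := hsupp _ hzB
    simp only [inner_add_right, inner_smul_right, inner_neg_right, hv,
      real_inner_self_eq_norm_sq, hθ] at this
    have e : a = 1 - b := by linarith
    subst e
    have : 0 < t * η := mul_pos t5 hη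
    nlinarith
  refine le_antisymm (not_lt.1 (main v hv)) ?_
  have := not_lt.1 (main (-v) (by simp [hv]))
  simpa using this

theorem fderiv_eq_smul_inner (h : IsBoundaryDefiningFunction B U ρ) (hxU : x ∈ U)
    (hx : x ∈ frontier B) (hθ : ‖θ‖ = 1) (hsupp : ∀ y ∈ frontier B, ⟪θ, y⟫ ≤ ⟪θ, x⟫)
    (v : EuclideanSpace ℝ (Fin d)) : fderiv ℝ ρ x v = fderiv ℝ ρ x θ * ⟪θ, v⟫ := by
  have := h.fderiv_eq_zero_of_inner_eq_zero hxU hx hθ hsupp (v := v - ⟪θ, v⟫ • θ) (by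
    simp [inner_sub_right, inner_smul_right, hθ])
  rw [map_sub, map_smul, smul_eq_mul] at this
  linarith

theorem fderiv_ne_zero_of_support (h : IsBoundaryDefiningFunction B U ρ) (hxU : x ∈ U)
    (hx : x ∈ frontier B) (hθ : ‖θ‖ = 1) (hsupp : ∀ y ∈ frontier B, ⟪θ, y⟫ ≤ ⟪θ, x⟫) :
    fderiv ℝ ρ x θ ≠ 0 := by
  intro h0
  refine h.fderiv_ne_zero x hxU hx ?_
  ext v
  rw [h.fderiv_eq_smul_inner hxU hx hθ hsupp, h0, zero_mul]
  rfl

/-- The Hessian of a defining function is nonnegative on a supporting hyperplane. -/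
theorem hessian_nonneg (h : IsBoundaryDefiningFunction B U ρ) (hxU : x ∈ U)
    (hx : x ∈ frontier B) (hθ : ‖θ‖ = 1) (hsupp : ∀ y ∈ frontier B, ⟪θ, y⟫ ≤ ⟪θ, x⟫)
    (hpos : 0 < fderiv ℝ ρ x θ) (hv : ⟪θ, v⟫ = 0) :
    0 ≤ fderiv ℝ (fderiv ℝ ρ) x v v := by
  by_contra! hneg
  set H := fderiv ℝ (fderiv ℝ ρ) x with hH
  set l := fderiv ℝ ρ x θ with hl
  -- Along `x + t • v + η t² • θ` the `t²`-coefficient of `ρ` is `l η + H v v / 2`. This `η` spends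
  -- half of the negative Hessian term and `ε` at most another quarter, so `ρ` stays negative
  -- although the curve is beyond the hyperplane. The segment to `x + s • θ + t • v`, where `ρ > 0`,
  -- then meets the boundary on the wrong side.
  set η := -(H v v) / (4 * l) with hη
  have hη0 : 0 < η := by apply div_pos <;> linarith
  set ε := -(H v v) / (8 * (‖v‖ ^ 2 + 1)) with hε
  have hε0 : 0 < ε := by apply div_pos; linarith; positivity
  obtain ⟨δ, hδ, htaylor⟩ := exists_forall_ball_abs_taylor_two_le (h.contDiffAt hxU) hε0
  obtain ⟨r, hr, hrU⟩ := Metric.isOpen_iff.1 h.isOpen x hxU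
  have h0 : ρ x = 0 := (h.mem_frontier_iff x hxU).1 hx
  have hdv : fderiv ℝ ρ x v = 0 := h.fderiv_eq_zero_of_inner_eq_zero hxU hx hθ hsupp hv
  obtain ⟨s, s1, s2, s3⟩ := ((h.eventually_pos hxU hx hpos).and
    (((tendsto_line (x := x) θ).eventually (Metric.ball_mem_nhds x hr)).and
      self_mem_nhdsWithin)).exists
  have s3 : 0 < s := s3
  have hcurve : Tendsto (fun t : ℝ => x + t • (v + (η * t) • θ)) (𝓝[>] 0) (𝓝 x) := by
    have : Continuous (fun t : ℝ => x + t • (v + (η * t) • θ)) := by fun_prop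
    simpa using (this.tendsto 0).mono_left nhdsWithin_le_nhds
  have htop : Tendsto (fun t : ℝ => x + s • θ + t • v) (𝓝[>] 0) (𝓝 (x + s • θ)) :=
    tendsto_line v
  have htopρ : ∀ᶠ t in 𝓝[>] (0 : ℝ), 0 < ρ (x + s • θ + t • v) := by
    have hc : ContinuousAt ρ (x + s • θ) := (h.differentiableAt (hrU s2)).continuousAt
    exact htop.eventually (hc.eventually (lt_mem_nhds s1))
  have hbr : ∀ᶠ t in 𝓝[>] (0 : ℝ), l * η + 1 / 2 * H (v + (η * t) • θ) (v + (η * t) • θ)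
      + ε * ‖v + (η * t) • θ‖ ^ 2 < 0 := by
    have hc : Continuous (fun t : ℝ => l * η + 1 / 2 * H (v + (η * t) • θ) (v + (η * t) • θ)
      + ε * ‖v + (η * t) • θ‖ ^ 2) := by fun_prop
    refine ((hc.tendsto 0).mono_left nhdsWithin_le_nhds).eventually (gt_mem_nhds ?_)
    have e1 : l * η = -(H v v) / 4 := by rw [hη]; field_simp
    have e2 : ε * ‖v‖ ^ 2 ≤ -(H v v) / 8 := by
      rw [hε, div_mul_eq_mul_div, div_le_div_iff₀ (by positivity) (by norm_num)]
      nlinarith [sq_nonneg ‖v‖]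
    simp only [mul_zero, zero_smul, add_zero, e1]
    linarith
  obtain ⟨t, t1, t2, t3, t4, t5, t6⟩ := (htopρ.and
    ((htop.eventually (Metric.isOpen_ball.mem_nhds s2)).and
    ((hcurve.eventually (Metric.ball_mem_nhds x hr)).and
    ((hcurve.eventually (Metric.ball_mem_nhds x hδ)).and (hbr.and self_mem_nhdsWithin))))).exists
  have t6 : 0 < t := t6
  have htay := (abs_le.1 (htaylor x (Metric.mem_ball_self hδ) _ t4)).2
  rw [← hH] at htay
  simp only [add_sub_cancel_left, map_smul, map_add, smul_eq_mul, hdv, h0,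
    smul_apply, norm_smul, Real.norm_of_nonneg t6.le, ← hl] at htay
  simp only [map_smul, map_add, smul_eq_mul] at t5
  have hlow : ρ (x + t • (v + (η * t) • θ)) ≤ 0 := by
    have := mul_neg_of_pos_of_neg (sq_pos_of_pos t6) t5
    nlinarith
  obtain ⟨z, hz, hzB⟩ := h.exists_mem_segment_frontier
      (((convex_ball x r).segment_subset t3 t2).trans hrU) hlow t1.le
  obtain ⟨a, b, ha, hb, hab, rfl⟩ := hz
  have := hsupp _ hzB
  simp only [inner_add_right, inner_smul_right, hv, real_inner_self_eq_norm_sq, hθ] at this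
  have e : a = 1 - b := by linarith
  subst e
  have q1 : 0 < t * (η * t) := by positivity
  have : 0 < (1 - b) * (t * (η * t)) + b * s := by
    rcases eq_or_lt_of_le hb with hb | hb
    · subst hb; linarith
    · have := mul_pos hb s3
      have := mul_nonneg ha q1.le
      linarith
  nlinarith

/-- At a point of nonzero Gaussian curvature the Hessian of a defining function is positive
definite on a supporting hyperplane. -/
theorem hessian_pos (h : IsBoundaryDefiningFunction B U ρ) (hxU : x ∈ U)
    (hx : x ∈ frontier B) (hθ : ‖θ‖ = 1) (hsupp : ∀ y ∈ frontier B, ⟪θ, y⟫ ≤ ⟪θ, x⟫)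
    (hpos : 0 < fderiv ℝ ρ x θ) (hcurv : gaussianCurvature ρ x ≠ 0) (hv : ⟪θ, v⟫ = 0)
    (hv0 : v ≠ 0) : 0 < fderiv ℝ (fderiv ℝ ρ) x v v := by
  set H := fderiv ℝ (fderiv ℝ ρ) x with hH
  have hsymm : ∀ a b, H a b = H b a :=
    fun a b => ((h.contDiffAt hxU).isSymmSndFDerivAt (by simp; norm_cast)) a b
  have hn : 0 < ‖fderiv ℝ ρ x‖ := norm_pos_iff.2 (h.fderiv_ne_zero x hxU hx)
  set b := stdOrthonormalBasis ℝ (levelTangentSpace ρ x) with hb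
  set A : Matrix _ _ ℝ := Matrix.of fun i j =>
    H (b i : EuclideanSpace ℝ (Fin d)) (b j : EuclideanSpace ℝ (Fin d)) / ‖fderiv ℝ ρ x‖ with hA
  have htan : ∀ w : EuclideanSpace ℝ (Fin d), w ∈ levelTangentSpace ρ x ↔ ⟪θ, w⟫ = 0 := by
    intro w
    have : w ∈ levelTangentSpace ρ x ↔ fderiv ℝ ρ x w = 0 := by
      simp [levelTangentSpace]
    rw [this, h.fderiv_eq_smul_inner hxU hx hθ hsupp, mul_eq_zero, or_iff_right hpos.ne']
  have hquad : ∀ c : Fin (Module.finrank ℝ (levelTangentSpace ρ x)) → ℝ,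
      c ⬝ᵥ (A.mulVec c) = H ((∑ i, c i • b i : levelTangentSpace ρ x) : EuclideanSpace ℝ (Fin d))
        ((∑ i, c i • b i : levelTangentSpace ρ x) : EuclideanSpace ℝ (Fin d))
          / ‖fderiv ℝ ρ x‖ := by
    intro c
    simp only [dotProduct, Matrix.mulVec, hA, Matrix.of_apply, AddSubmonoidClass.coe_finsetSum,
      Submodule.coe_smul, map_sum, map_smul, sum_apply,
      smul_apply, smul_eq_mul, Finset.sum_div, Finset.mul_sum]
    rw [Finset.sum_comm]
    refine Finset.sum_congr rfl fun i _ => Finset.sum_congr rfl fun j _ => ?_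
    ring
  have hpsd : A.PosSemidef := by
    refine Matrix.PosSemidef.of_dotProduct_mulVec_nonneg ?_ ?_
    · ext i j
      simp [hA, hsymm (b i : EuclideanSpace ℝ (Fin d))]
    · intro c
      rw [star_trivial, hquad]
      refine div_nonneg (h.hessian_nonneg hxU hx hθ hsupp hpos ?_) hn.le
      exact (htan _).1 (Submodule.coe_mem _)
  -- A positive semidefinite matrix with nonzero determinant is positive definite; this is where the
  -- curvature hypothesis enters.
  have hpd : A.PosDef := hpsd.posDef_iff_isUnit.2
    ((Matrix.isUnit_iff_isUnit_det A).2 (isUnit_iff_ne_zero.2 hcurv))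
  set v' : levelTangentSpace ρ x := ⟨v, (htan v).2 hv⟩ with hv'
  have hsum : ∑ i, (fun i => b.repr v' i) i • b i = v' := b.sum_repr v'
  have hne : (fun i => b.repr v' i) ≠ 0 := by
    intro h0
    rw [h0] at hsum
    simp only [Pi.zero_apply, zero_smul, Finset.sum_const_zero] at hsum
    exact hv0 (congrArg Subtype.val hsum.symm)
  have := hpd.dotProduct_mulVec_pos hne
  rw [star_trivial, hquad, hsum] at this
  exact (div_pos_iff_of_pos_right hn).1 this

end IsBoundaryDefiningFunction

end BoundaryDefiningFunction

/-! ### Uniform strong convexity by compactness. -/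

namespace IsSmoothCurvedSymmetricBody

open Set Filter Topology
open scoped RealInnerProductSpace

variable {d : ℕ} {B : Set (EuclideanSpace ℝ (Fin d))}

theorem zero_mem_interior (hB : IsSmoothCurvedSymmetricBody B) : 0 ∈ interior B := by
  obtain ⟨a, ha⟩ := hB.interior_nonempty
  have hneg : Homeomorph.neg (EuclideanSpace ℝ (Fin d)) ⁻¹' B = B := by
    ext x
    exact ⟨fun hx => by simpa using hB.symmetric _ hx, fun hx => hB.symmetric _ hx⟩
  have ha' : -a ∈ interior B := by
    rw [← hneg, ← Homeomorph.preimage_interior] at ha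
    exact ha
  have := hB.convex.interior ha ha' (a := 1 / 2) (b := 1 / 2) (by norm_num) (by norm_num)
    (by norm_num)
  simpa using this

theorem isCompact_closure (hB : IsSmoothCurvedSymmetricBody B) : IsCompact (closure B) :=
  hB.bounded.isCompact_closure

theorem inner_lt_of_mem_interior {x θ z : EuclideanSpace ℝ (Fin d)} (hθ : θ ≠ 0)
    (hsupp : ∀ y ∈ closure B, ⟪θ, y⟫ ≤ ⟪θ, x⟫) (hz : z ∈ interior B) : ⟪θ, z⟫ < ⟪θ, x⟫ := by
  have hc : Tendsto (fun t : ℝ => z + t • θ) (𝓝[>] 0) (𝓝 z) :=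
    IsBoundaryDefiningFunction.tendsto_line θ
  obtain ⟨t, ht, ht0⟩ := ((hc.eventually (isOpen_interior.mem_nhds hz)).and
    self_mem_nhdsWithin).exists
  have h1 := hsupp _ (subset_closure (interior_subset ht))
  have h2 : 0 < t * ⟪θ, θ⟫ := mul_pos ht0 (real_inner_self_pos.2 hθ)
  simp only [inner_add_right, inner_smul_right] at h1
  linarith

theorem mem_frontier_of_support {x θ : EuclideanSpace ℝ (Fin d)} (hθ : θ ≠ 0)
    (hx : x ∈ closure B) (hsupp : ∀ y ∈ closure B, ⟪θ, y⟫ ≤ ⟪θ, x⟫) : x ∈ frontier B :=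
  ⟨hx, fun hxi => lt_irrefl _ (inner_lt_of_mem_interior hθ hsupp hxi)⟩

/-- The compactness core of strong convexity. If chords of the body issuing from `x m` fell only
`o(h²)` below the supporting hyperplanes, a nonzero limit direction would be tangent. Dividing the
Taylor expansion of `ρ` by `h²` would then contradict positivity of the Hessian at the limit point.
-/
theorem not_tendsto_flat (hB : IsSmoothCurvedSymmetricBody B)
    {x θ w : ℕ → EuclideanSpace ℝ (Fin d)} {h e : ℕ → ℝ}
    {x₀ θ₀ w₀ : EuclideanSpace ℝ (Fin d)} (hx : ∀ m, x m ∈ frontier B) (hθ : ∀ m, ‖θ m‖ = 1)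
    (hsupp : ∀ m, ∀ y ∈ closure B, ⟪θ m, y⟫ ≤ ⟪θ m, x m⟫) (hh : ∀ m, 0 < h m)
    (hh0 : Tendsto h atTop (𝓝 0)) (he0 : Tendsto e atTop (𝓝 0))
    (hmem : ∀ m, x m + h m • w m ∈ closure B) (hflat : ∀ m, -⟪θ m, w m⟫ ≤ h m * e m)
    (hx0 : Tendsto x atTop (𝓝 x₀)) (hθ0 : Tendsto θ atTop (𝓝 θ₀))
    (hw0 : Tendsto w atTop (𝓝 w₀)) : w₀ = 0 := by
  by_contra hne
  have hx₀ : x₀ ∈ frontier B := isClosed_frontier.mem_of_tendsto hx0 (Eventually.of_forall hx)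
  have hθ₀ : ‖θ₀‖ = 1 :=
    tendsto_nhds_unique hθ0.norm (by simp [hθ])
  have hθne : θ₀ ≠ 0 := norm_ne_zero_iff.1 (by simp [hθ₀])
  have hsupp₀ : ∀ y ∈ closure B, ⟪θ₀, y⟫ ≤ ⟪θ₀, x₀⟫ := fun y hy =>
    le_of_tendsto_of_tendsto' (hθ0.inner tendsto_const_nhds) (hθ0.inner hx0)
      fun m => hsupp m y hy
  have hfr : ∀ {x θ : EuclideanSpace ℝ (Fin d)}, (∀ y ∈ closure B, ⟪θ, y⟫ ≤ ⟪θ, x⟫) →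
      ∀ y ∈ frontier B, ⟪θ, y⟫ ≤ ⟪θ, x⟫ := fun h y hy => h y hy.1
  obtain ⟨U, ρ, hxU, hρ, hpos⟩ : ∃ U ρ, x₀ ∈ U ∧ IsBoundaryDefiningFunction B U ρ ∧
      0 < fderiv ℝ ρ x₀ θ₀ := by
    obtain ⟨U, ρ, hxU, hρ⟩ := hB.smooth_boundary x₀ hx₀
    rcases lt_or_gt_of_ne (hρ.fderiv_ne_zero_of_support hxU hx₀ hθ₀ (hfr hsupp₀)) with h1 | h1
    · exact ⟨U, fun x => -ρ x, hxU, hρ.neg, by simpa [fderiv_fun_neg] using h1⟩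
    · exact ⟨U, ρ, hxU, hρ, h1⟩
  set H := fderiv ℝ (fderiv ℝ ρ) x₀ with hH
  -- the limit direction is tangent
  have htan : ⟪θ₀, w₀⟫ = 0 := by
    refine le_antisymm ?_ ?_
    · refine le_of_tendsto' (hθ0.inner hw0) fun m => ?_
      have := hsupp m _ (hmem m)
      simp only [inner_add_right, inner_smul_right] at this
      exact (mul_nonpos_iff_pos_imp_nonpos.1 (by linarith : h m * ⟪θ m, w m⟫ ≤ 0)).1 (hh m)
    · have := le_of_tendsto_of_tendsto' (hθ0.inner hw0).neg (hh0.mul he0) hflat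
      simpa using this
  have hHpos : 0 < H w₀ w₀ := hρ.hessian_pos hxU hx₀ hθ₀ (hfr hsupp₀) hpos
    (hB.curvature U ρ hρ x₀ hxU hx₀) htan hne
  obtain ⟨r, hr, hrU⟩ := Metric.isOpen_iff.1 hρ.isOpen x₀ hxU
  have hy0 : Tendsto (fun m => x m + h m • w m) atTop (𝓝 x₀) := by
    simpa using hx0.add (hh0.smul hw0)
  -- the defining function is nonpositive at nearby points of the body
  have hnonpos : ∀ᶠ m in atTop, ρ (x m + h m • w m) ≤ 0 := by
    -- Moving towards the origin, an interior point, strictly decreases `ρ`; this fixes which side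
    -- of the boundary carries the negative sign.
    have hdx : 0 < fderiv ℝ (fun x => -ρ x) x₀ (-x₀) := by
      rw [fderiv_fun_neg, neg_apply, map_neg, neg_neg,
        hρ.fderiv_eq_smul_inner hxU hx₀ hθ₀ (hfr hsupp₀)]
      refine mul_pos hpos ?_
      simpa using inner_lt_of_mem_interior hθne hsupp₀ hB.zero_mem_interior
    obtain ⟨t, t1, t2, t3⟩ := ((hρ.neg.eventually_pos hxU hx₀ hdx).and
      (((IsBoundaryDefiningFunction.tendsto_line (x := x₀) (-x₀)).eventually
        (Metric.ball_mem_nhds x₀ hr)).and (Ioo_mem_nhdsGT (zero_lt_one' ℝ)))).exists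
    have hyt : Tendsto (fun m => (x m + h m • w m) + t • -(x m + h m • w m)) atTop
        (𝓝 (x₀ + t • -x₀)) := hy0.add (hy0.neg.const_smul t)
    have hc : ContinuousAt ρ (x₀ + t • -x₀) := (hρ.differentiableAt (hrU t2)).continuousAt
    have ev := hyt.eventually (hc.eventually (gt_mem_nhds (by linarith : ρ (x₀ + t • -x₀) < 0)))
    filter_upwards [ev, hyt.eventually (Metric.isOpen_ball.mem_nhds t2),
      hy0.eventually (Metric.ball_mem_nhds x₀ hr)] with m m1 m2 m3
    -- Otherwise `ρ` vanishes at some `(1 - a t) • y` with `a > 0`. That point is a proper convex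
    -- combination of `y` and the interior point 0, hence interior, and cannot be on the boundary.
    by_contra! hcon
    set y := x m + h m • w m with hy
    obtain ⟨z, hz, hzB⟩ := hρ.exists_mem_segment_frontier
      (((convex_ball x₀ r).segment_subset m2 m3).trans hrU) m1.le hcon.le
    obtain ⟨a, b, ha, hb, hab, rfl⟩ := hz
    have hz0 := (hρ.mem_frontier_iff _ (hrU ((convex_ball x₀ r).segment_subset m2 m3
      ⟨a, b, ha, hb, hab, rfl⟩))).1 hzB
    have ha0 : 0 < a := by
      rcases eq_or_lt_of_le ha with h0 | h0
      · subst h0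
        have : b = 1 := by linarith
        subst this
        simp only [zero_smul, zero_add, one_smul] at hz0
        linarith
      · exact h0
    refine hzB.2 ?_
    have := hB.convex.combo_interior_closure_mem_interior hB.zero_mem_interior (hmem m)
      (a := a * t) (b := 1 - a * t) (mul_pos ha0 t3.1) (by nlinarith [t3.1, t3.2]) (by ring)
    convert this using 1
    rw [← hy, show b = 1 - a by linarith]
    module
  -- With this `ε` the Taylor error costs at most half of `H w₀ w₀ / 2` in the limit.
  obtain ⟨δ, hδ, htaylor⟩ := exists_forall_ball_abs_taylor_two_le (hρ.contDiffAt hxU)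
    (ε := H w₀ w₀ / (4 * (‖w₀‖ ^ 2 + 1))) (by positivity)
  set ε := H w₀ w₀ / (4 * (‖w₀‖ ^ 2 + 1)) with hε
  have hfd : ContinuousAt (fderiv ℝ ρ) x₀ :=
    ((hρ.contDiffAt hxU).fderiv_right (m := 1) (by norm_cast)).continuousAt
  have hl0 : Tendsto (fun m => fderiv ℝ ρ (x m) (θ m)) atTop (𝓝 (fderiv ℝ ρ x₀ θ₀)) :=
    (isBoundedBilinearMap_apply.continuous.tendsto (fderiv ℝ ρ x₀, θ₀)).comp
      ((hfd.tendsto.comp hx0).prodMk_nhds hθ0)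
  have hineq : ∀ᶠ m in atTop, 1 / 2 * H (w m) (w m) - ε * ‖w m‖ ^ 2 ≤
      fderiv ℝ ρ (x m) (θ m) * e m := by
    filter_upwards [hnonpos, hx0.eventually (Metric.ball_mem_nhds x₀ hδ),
      hy0.eventually (Metric.ball_mem_nhds x₀ hδ), hx0.eventually (Metric.ball_mem_nhds x₀ hr),
      hl0.eventually (lt_mem_nhds hpos)] with m m1 m2 m3 m4 m5
    have ht := (abs_le.1 (htaylor _ m2 _ m3)).1
    rw [← hH] at ht
    simp only [add_sub_cancel_left, map_smul, smul_apply, smul_eq_mul, norm_smul,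
      Real.norm_of_nonneg (hh m).le, (hρ.mem_frontier_iff _ (hrU m4)).1 (hx m)] at ht
    rw [hρ.fderiv_eq_smul_inner (hrU m4) (hx m) (hθ m) (hfr (hsupp m))] at ht
    have h1 := mul_le_mul_of_nonneg_left (hflat m) (mul_nonneg m5.le (hh m).le)
    have h2 := sq_pos_of_pos (hh m)
    refine le_of_mul_le_mul_left ?_ h2
    nlinarith
  have hlim : Tendsto (fun m => 1 / 2 * H (w m) (w m) - ε * ‖w m‖ ^ 2) atTop
      (𝓝 (1 / 2 * H w₀ w₀ - ε * ‖w₀‖ ^ 2)) := by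
    have hc : Continuous (fun v => 1 / 2 * H v v - ε * ‖v‖ ^ 2) := by fun_prop
    exact (hc.tendsto w₀).comp hw0
  have := le_of_tendsto_of_tendsto hlim (hl0.mul he0) hineq
  have e2 : ε * ‖w₀‖ ^ 2 ≤ H w₀ w₀ / 4 := by
    rw [hε, div_mul_eq_mul_div, div_le_div_iff₀ (by positivity) (by norm_num)]
    nlinarith [sq_nonneg ‖w₀‖]
  linarith

/-- Uniform strong convexity: every point of the body lies quadratically below every supporting
hyperplane. -/
theorem exists_forall_le_inner_sub (hB : IsSmoothCurvedSymmetricBody B) :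
    ∃ κ > 0, ∀ θ : EuclideanSpace ℝ (Fin d), ∀ x ∈ closure B,
      (∀ y ∈ closure B, ⟪θ, y⟫ ≤ ⟪θ, x⟫) → ∀ y ∈ closure B,
        κ * ‖θ‖ * ‖x - y‖ ^ 2 ≤ ⟪θ, x - y⟫ := by
  suffices hunit : ∃ κ > 0, ∀ θ : EuclideanSpace ℝ (Fin d), ‖θ‖ = 1 → ∀ x ∈ closure B,
      (∀ y ∈ closure B, ⟪θ, y⟫ ≤ ⟪θ, x⟫) → ∀ y ∈ closure B, κ * ‖x - y‖ ^ 2 ≤ ⟪θ, x - y⟫ by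
    obtain ⟨κ, hκ, hk⟩ := hunit
    refine ⟨κ, hκ, fun θ x hx hsupp y hy => ?_⟩
    rcases eq_or_ne θ 0 with rfl | hθ
    · simp
    have hn : 0 < ‖θ‖ := norm_pos_iff.2 hθ
    have := hk (‖θ‖⁻¹ • θ) (by rw [norm_smul, norm_inv, norm_norm, inv_mul_cancel₀ hn.ne']) x hx
      (fun y hy => by
        simp only [inner_smul_left, conj_trivial]
        exact mul_le_mul_of_nonneg_left (hsupp y hy) (by positivity)) y hy
    simp only [inner_smul_left, conj_trivial] at this
    rw [inv_mul_eq_div, le_div_iff₀ hn] at this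
    linarith
  by_contra! hcon
  -- The constant is a square so that it splits: one factor `1/(m+1)` shortens the chord, the other
  -- remains as the vanishing flatness `e`.
  have hsel : ∀ m : ℕ, ∃ z : EuclideanSpace ℝ (Fin d) × EuclideanSpace ℝ (Fin d) ×
      EuclideanSpace ℝ (Fin d), ‖z.2.1‖ = 1 ∧ z.1 ∈ closure B ∧
        (∀ y ∈ closure B, ⟪z.2.1, y⟫ ≤ ⟪z.2.1, z.1⟫) ∧ z.2.2 ∈ closure B ∧
        ⟪z.2.1, z.1 - z.2.2⟫ < 1 / ((m : ℝ) + 1) ^ 2 * ‖z.1 - z.2.2‖ ^ 2 := by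
    intro m
    obtain ⟨θ, h1, x, h2, h3, y, h4, h5⟩ := hcon (1 / ((m : ℝ) + 1) ^ 2) (by positivity)
    exact ⟨(x, θ, y), h1, h2, h3, h4, h5⟩
  choose z hz1 hz2 hz3 hz4 hz5 using hsel
  have hn : ∀ m, 0 < ‖(z m).1 - (z m).2.2‖ := by
    intro m
    rw [norm_pos_iff, sub_ne_zero]
    intro h0
    have := hz5 m
    rw [h0] at this
    simp at this
  obtain ⟨D, hD⟩ := Metric.isBounded_iff.1 hB.isCompact_closure.isBounded
  set w : ℕ → EuclideanSpace ℝ (Fin d) :=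
    fun m => ‖(z m).1 - (z m).2.2‖⁻¹ • ((z m).2.2 - (z m).1) with hw
  have hwn : ∀ m, ‖w m‖ = 1 := by
    intro m
    rw [hw]
    simp only [norm_smul, norm_inv, norm_norm, norm_sub_rev (z m).2.2]
    exact inv_mul_cancel₀ (hn m).ne'
  have hK : IsCompact (closure B ×ˢ (Metric.sphere (0 : EuclideanSpace ℝ (Fin d)) 1 ×ˢ
      Metric.sphere (0 : EuclideanSpace ℝ (Fin d)) 1)) :=
    hB.isCompact_closure.prod ((isCompact_sphere _ _).prod (isCompact_sphere _ _))
  obtain ⟨⟨x₀, θ₀, w₀⟩, hmem₀, φ, hφ, hlim⟩ := hK.tendsto_subseq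
    (x := fun m => ((z m).1, (z m).2.1, w m))
    (fun m => ⟨hz2 m, by simp [hz1 m], by simp [hwn m]⟩)
  have hlim1 := (continuous_fst.tendsto _).comp hlim
  have hlim2 := ((continuous_fst.comp continuous_snd).tendsto _).comp hlim
  have hlim3 := ((continuous_snd.comp continuous_snd).tendsto _).comp hlim
  have hinv : Tendsto (fun m : ℕ => 1 / ((φ m : ℝ) + 1)) atTop (𝓝 0) :=
    tendsto_one_div_add_atTop_nhds_zero_nat.comp hφ.tendsto_atTop
  have hzero : w₀ = 0 := by
    -- The two points need not approach each other, so the second is replaced by the point a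
    -- fraction `1/(φ m + 1)` of the way along the chord. It is in the closure by convexity.
    refine hB.not_tendsto_flat (x := fun m => (z (φ m)).1) (θ := fun m => (z (φ m)).2.1)
      (w := fun m => w (φ m)) (h := fun m => 1 / ((φ m : ℝ) + 1) * ‖(z (φ m)).1 - (z (φ m)).2.2‖)
      (e := fun m => 1 / ((φ m : ℝ) + 1)) ?_ (fun m => hz1 _) (fun m => hz3 _) ?_ ?_ hinv ?_ ?_
      hlim1 hlim2 hlim3
    · intro m
      refine mem_frontier_of_support (norm_ne_zero_iff.1 ?_) (hz2 _) (hz3 _)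
      simp [hz1]
    · intro m
      have := hn (φ m)
      positivity
    · refine squeeze_zero (g := fun m => 1 / ((φ m : ℝ) + 1) * D) (fun m => by positivity)
        (fun m => ?_) (by simpa using hinv.mul_const D)
      gcongr
      rw [← dist_eq_norm]
      exact hD (hz2 _) (hz4 _)
    · intro m
      have : (z (φ m)).1 + (1 / ((φ m : ℝ) + 1) * ‖(z (φ m)).1 - (z (φ m)).2.2‖) • w (φ m)
          = (z (φ m)).1 + (1 / ((φ m : ℝ) + 1)) • ((z (φ m)).2.2 - (z (φ m)).1) := by
        simp only [hw, smul_smul, mul_assoc, mul_inv_cancel₀ (hn (φ m)).ne', mul_one]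
      rw [this]
      refine hB.convex.closure.add_smul_sub_mem (hz2 _) (hz4 _) ⟨by positivity, ?_⟩
      rw [div_le_one (by positivity)]
      linarith [(φ m).cast_nonneg (α := ℝ)]
    · intro m
      have h5 := hz5 (φ m)
      have hp := hn (φ m)
      simp only [hw, inner_smul_right]
      rw [← neg_sub (z (φ m)).1, inner_neg_right, mul_neg, neg_neg, inv_mul_le_iff₀ hp]
      refine h5.le.trans (le_of_eq ?_)
      field_simp
  have : ‖w₀‖ = 1 := by simpa using hmem₀.2.2
  simp [hzero] at this

end IsSmoothCurvedSymmetricBody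

/-! ### Volumes of boxes and of sets of normals. -/

section Volume

open MeasureTheory Set
open scoped RealInnerProductSpace ENNReal

variable {d : ℕ}

theorem exists_orthonormalBasis_apply_eq (i₀ : Fin d) {e : EuclideanSpace ℝ (Fin d)}
    (he : ‖e‖ = 1) : ∃ b : OrthonormalBasis (Fin d) ℝ (EuclideanSpace ℝ (Fin d)), b i₀ = e := by
  obtain ⟨b, hb⟩ := Orthonormal.exists_orthonormalBasis_extension_of_card_eq (𝕜 := ℝ)
    (E := EuclideanSpace ℝ (Fin d)) (ι := Fin d) (by simp) (v := fun _ => e) (s := {i₀}) (by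
      refine ⟨fun _ => he, fun i j hij => ?_⟩
      exact absurd (Subsingleton.elim i j) hij)
  exact ⟨b, hb i₀ rfl⟩

theorem measurableSet_box (b : OrthonormalBasis (Fin d) ℝ (EuclideanSpace ℝ (Fin d)))
    (i₀ : Fin d) (l u a : ℝ) :
    MeasurableSet {x : EuclideanSpace ℝ (Fin d) |
      ⟪b i₀, x⟫ ∈ Icc l u ∧ ∀ i ≠ i₀, |⟪b i, x⟫| ≤ a} := by
  have : {x : EuclideanSpace ℝ (Fin d) | ⟪b i₀, x⟫ ∈ Icc l u ∧ ∀ i ≠ i₀, |⟪b i, x⟫| ≤ a}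
      = {x | ⟪b i₀, x⟫ ∈ Icc l u} ∩ ⋂ i, ⋂ (_ : i ≠ i₀), {x | |⟪b i, x⟫| ≤ a} := by
    ext x; simp
  rw [this]
  refine IsClosed.measurableSet (IsClosed.inter (isClosed_Icc.preimage (by fun_prop)) ?_)
  exact isClosed_iInter fun i => isClosed_iInter fun _ =>
    isClosed_le (by fun_prop) continuous_const

theorem volume_box (b : OrthonormalBasis (Fin d) ℝ (EuclideanSpace ℝ (Fin d)))
    (i₀ : Fin d) (l u a : ℝ) :
    volume {x : EuclideanSpace ℝ (Fin d) | ⟪b i₀, x⟫ ∈ Icc l u ∧ ∀ i ≠ i₀, |⟪b i, x⟫| ≤ a}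
      = ENNReal.ofReal (u - l) * ENNReal.ofReal (2 * a) ^ (d - 1) := by
  have hmp := (PiLp.volume_preserving_ofLp (Fin d)).comp b.measurePreserving_repr
  have hset : {x : EuclideanSpace ℝ (Fin d) | ⟪b i₀, x⟫ ∈ Icc l u ∧ ∀ i ≠ i₀, |⟪b i, x⟫| ≤ a}
      = (WithLp.ofLp ∘ b.repr) ⁻¹' Icc (Function.update (fun _ => -a) i₀ l)
        (Function.update (fun _ => a) i₀ u) := by
    ext x
    simp only [mem_ofPred_eq, mem_preimage, Function.comp, mem_Icc, Pi.le_def,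
      Function.update_apply, b.repr_apply_apply, abs_le]
    constructor
    · rintro ⟨⟨h1, h2⟩, h3⟩
      refine ⟨fun i => ?_, fun i => ?_⟩ <;> split_ifs with hi
      · rw [hi]; exact h1
      · exact (h3 i hi).1
      · rw [hi]; exact h2
      · exact (h3 i hi).2
    · rintro ⟨h1, h2⟩
      refine ⟨⟨by simpa using h1 i₀, by simpa using h2 i₀⟩, fun i hi => ?_⟩
      have := h1 i
      have := h2 i
      simp_all
  rw [hset, hmp.measure_preimage measurableSet_Icc.nullMeasurableSet, Real.volume_Icc_pi,
    ← Finset.mul_prod_erase _ _ (Finset.mem_univ i₀)]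
  congr 1
  · simp
  · rw [Finset.prod_congr rfl (g := fun _ => ENNReal.ofReal (2 * a))]
    · simp
    · intro i hi
      rw [Function.update_of_ne (Finset.ne_of_mem_erase hi),
        Function.update_of_ne (Finset.ne_of_mem_erase hi)]
      congr 1; ring

/-- In an orthonormal basis containing `v / ‖v‖`, the slab condition confines one coordinate to an
interval of length `2s / ‖v‖`. This is the source of the weight `1 / |p - p'|` in the count. -/
theorem volume_ball_inter_slab_le (hd : 0 < d) {v : EuclideanSpace ℝ (Fin d)} (hv : v ≠ 0)
    (M s : ℝ) :
    volume {θ : EuclideanSpace ℝ (Fin d) | ‖θ‖ ≤ M ∧ |⟪θ, v⟫| ≤ s}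
      ≤ ENNReal.ofReal (2 * s / ‖v‖) * ENNReal.ofReal (2 * M) ^ (d - 1) := by
  have hn : 0 < ‖v‖ := norm_pos_iff.2 hv
  obtain ⟨b, hb⟩ := exists_orthonormalBasis_apply_eq (⟨0, hd⟩ : Fin d) (e := ‖v‖⁻¹ • v)
    (by rw [norm_smul, norm_inv, norm_norm, inv_mul_cancel₀ hn.ne'])
  have := volume_box b ⟨0, hd⟩ (-(s / ‖v‖)) (s / ‖v‖) M
  rw [show s / ‖v‖ - -(s / ‖v‖) = 2 * s / ‖v‖ by ring] at this
  rw [← this]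
  refine measure_mono fun θ hθ => ⟨?_, fun i _ => ?_⟩
  · rw [hb, inner_smul_left, conj_trivial, real_inner_comm, mem_Icc, ← abs_le, abs_mul, abs_inv,
      abs_norm, inv_mul_eq_div]
    gcongr
    exact hθ.2
  · refine (abs_real_inner_le_norm _ _).trans ?_
    rw [b.norm_eq_one, one_mul]
    exact hθ.1

end Volume

/-! ### Packing bounds for separated sets. -/

section Separated

open MeasureTheory Set
open scoped RealInnerProductSpace ENNReal

variable {d : ℕ} {c : ℝ} {P : Finset (EuclideanSpace ℝ (Fin d))}

theorem card_filter_dist_le_mul_pow_le (hc : 0 < c)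
    (hsep : ∀ p ∈ P, ∀ p' ∈ P, p ≠ p' → c ≤ dist p p') (p : EuclideanSpace ℝ (Fin d)) {r : ℝ}
    (hr : 0 ≤ r) :
    ((P.filter fun q => dist p q ≤ r).card : ℝ) * (c / 2) ^ d ≤ (r + c / 2) ^ d := by
  set Q := P.filter fun q => dist p q ≤ r with hQ
  have hdisj : (Q : Set (EuclideanSpace ℝ (Fin d))).PairwiseDisjoint
      fun q => Metric.ball q (c / 2) := by
    intro q hq q' hq' hne
    refine Metric.ball_disjoint_ball ?_
    have := hsep q (Finset.mem_filter.1 hq).1 q' (Finset.mem_filter.1 hq').1 hne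
    linarith
  have hle : volume (⋃ q ∈ Q, Metric.ball q (c / 2)) ≤ volume (Metric.closedBall p (r + c / 2)) := by
    refine measure_mono (iUnion₂_subset fun q hq x hx => ?_)
    have h1 := (Finset.mem_filter.1 hq).2
    have h2 := Metric.mem_ball.1 hx
    have h3 := dist_triangle x q p
    rw [dist_comm q p] at h3
    rw [Metric.mem_closedBall]
    linarith
  rw [measure_biUnion_finset hdisj fun q _ => measurableSet_ball] at hle
  simp_rw [Measure.addHaar_ball_of_pos volume _ (half_pos hc)] at hle
  rw [Measure.addHaar_closedBall volume _ (by positivity), Finset.sum_const, nsmul_eq_mul,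
    ← mul_assoc, ENNReal.mul_le_mul_iff_left (Metric.measure_ball_pos _ _ one_pos).ne'
      measure_ball_lt_top.ne, ← ENNReal.ofReal_natCast, ← ENNReal.ofReal_mul (by positivity),
    ENNReal.ofReal_le_ofReal_iff (by positivity)] at hle
  simpa using hle

theorem card_filter_dist_le_le (hc : 0 < c)
    (hsep : ∀ p ∈ P, ∀ p' ∈ P, p ≠ p' → c ≤ dist p p') (p : EuclideanSpace ℝ (Fin d)) {r : ℝ}
    (hr : c ≤ r) : ((P.filter fun q => dist p q ≤ r).card : ℝ) ≤ (3 / c) ^ d * r ^ d := by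
  have h1 := card_filter_dist_le_mul_pow_le hc hsep p (hc.le.trans hr)
  have h2 : (r + c / 2) ^ d ≤ ((3 / c) ^ d * r ^ d) * (c / 2) ^ d := by
    rw [← mul_pow, ← mul_pow]
    have : 3 / c * r * (c / 2) = 3 / 2 * r := by field_simp
    rw [this]
    have : 0 ≤ r := hc.le.trans hr
    gcongr
    linarith
  exact le_of_mul_le_mul_right (h1.trans h2) (by positivity)

/-- Dyadic decomposition: the points with `r/2 < dist p q ≤ r` number `O(r^d)` and each weighs at
most `2/r`. The induction on `m` runs over scales and starts below the separation `c`, where the sum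
is empty. -/
theorem sum_inv_dist_le (hd : 2 ≤ d) (hc : 0 < c)
    (hsep : ∀ p ∈ P, ∀ p' ∈ P, p ≠ p' → c ≤ dist p p') {p : EuclideanSpace ℝ (Fin d)}
    (hp : p ∈ P) {r : ℝ} (hr : 0 < r) :
    ∑ q ∈ P.filter (fun q => q ≠ p ∧ dist p q ≤ r), (dist p q)⁻¹
      ≤ 4 * (3 / c) ^ d * r ^ (d - 1) := by
  have main : ∀ m : ℕ, ∀ r : ℝ, 0 < r → r < c * 2 ^ m →
      ∑ q ∈ P.filter (fun q => q ≠ p ∧ dist p q ≤ r), (dist p q)⁻¹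
        ≤ 4 * (3 / c) ^ d * r ^ (d - 1) := by
    intro m
    induction m with
    | zero =>
      intro r hr hrc
      rw [Finset.filter_eq_empty_iff.2, Finset.sum_empty]
      · positivity
      · rintro q hq ⟨hne, hle⟩
        have := hsep p hp q hq hne.symm
        simp at hrc
        linarith
    | succ m ih =>
      intro r hr hrm
      rcases lt_or_ge r c with hrc | hrc
      · rw [Finset.filter_eq_empty_iff.2, Finset.sum_empty]
        · positivity
        · rintro q hq ⟨hne, hle⟩
          have := hsep p hp q hq hne.symm
          linarith
      have h1 := ih (r / 2) (half_pos hr) (by rw [pow_succ] at hrm; linarith)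
      have h2 := card_filter_dist_le_le hc hsep p hrc
      have hsplit : ∑ q ∈ P.filter (fun q => q ≠ p ∧ dist p q ≤ r), (dist p q)⁻¹ ≤
          ∑ q ∈ P.filter (fun q => q ≠ p ∧ dist p q ≤ r / 2), (dist p q)⁻¹ +
          ∑ q ∈ P.filter (fun q => dist p q ≤ r), (r / 2)⁻¹ := by
        rw [Finset.sum_filter, Finset.sum_filter, Finset.sum_filter, ← Finset.sum_add_distrib]
        refine Finset.sum_le_sum fun q _ => ?_
        have hq0 : 0 ≤ (dist p q)⁻¹ := by positivity
        have hr0 : 0 ≤ (r / 2)⁻¹ := by positivity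
        by_cases h3 : q ≠ p ∧ dist p q ≤ r
        · rw [if_pos h3, if_pos h3.2]
          split_ifs with h4
          · linarith
          · have h5 : r / 2 ≤ dist p q := by
              by_contra! h6
              exact h4 ⟨h3.1, h6.le⟩
            rw [zero_add]
            exact inv_anti₀ (by positivity) h5
        · rw [if_neg h3]
          split_ifs <;> positivity
      rw [Finset.sum_const, nsmul_eq_mul] at hsplit
      have h3 : ((P.filter fun q => dist p q ≤ r).card : ℝ) * (r / 2)⁻¹
          ≤ 2 * (3 / c) ^ d * r ^ (d - 1) := by
        calc _ ≤ ((3 / c) ^ d * r ^ d) * (r / 2)⁻¹ := by gcongr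
          _ = _ := by
            obtain ⟨j, rfl⟩ : ∃ j, d = j + 1 := ⟨d - 1, by omega⟩
            rw [Nat.add_sub_cancel, pow_succ r]
            field_simp
      -- Here `d ≥ 2` makes the scales sum geometrically: the inner half contributes at most half of
      -- the constant 4 and the outer shell the other half.
      have h4 : (r / 2) ^ (d - 1) ≤ r ^ (d - 1) / 2 := by
        obtain ⟨j, rfl⟩ : ∃ j, d = j + 2 := ⟨d - 2, by omega⟩
        rw [show j + 2 - 1 = j + 1 by omega, pow_succ, pow_succ, mul_div_assoc]
        gcongr
        linarith
      have h5 : 4 * (3 / c) ^ d * (r / 2) ^ (d - 1) ≤ 4 * (3 / c) ^ d * (r ^ (d - 1) / 2) := by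
        gcongr
      linarith
  obtain ⟨m, hm⟩ := pow_unbounded_of_one_lt (r / c) (one_lt_two : (1 : ℝ) < 2)
  refine main m r hr ?_
  rwa [div_lt_iff₀' hc] at hm

end Separated

/-! ### Translated slabs against centred slabs. -/

section Shift

open MeasureTheory Set
open scoped RealInnerProductSpace ENNReal

variable {d : ℕ}

/-- The part of the ball of radius `r` that lies in a slab orthogonal to `θ`. -/
def slabBall (θ : EuclideanSpace ℝ (Fin d)) (s r : ℝ) : Set (EuclideanSpace ℝ (Fin d)) :=
  {v | |⟪θ, v⟫| ≤ s ∧ ‖v‖ ≤ r}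

variable {θ v w : EuclideanSpace ℝ (Fin d)} {s r s₂ r₂ : ℝ}

theorem isClosed_slabBall : IsClosed (slabBall θ s r) :=
  IsClosed.and (isClosed_le (f := fun v => |⟪θ, v⟫|) (by fun_prop) continuous_const)
    (isClosed_le (f := fun v => ‖v‖) (by fun_prop) continuous_const)

theorem sub_mem_slabBall (hv : v ∈ slabBall θ s r) (hw : w ∈ slabBall θ s₂ r₂) :
    v - w ∈ slabBall θ (s + s₂) (r + r₂) := by
  refine ⟨?_, (norm_sub_le _ _).trans (add_le_add hv.2 hw.2)⟩
  rw [inner_sub_right]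
  exact (abs_sub _ _).trans (add_le_add hv.1 hw.1)

theorem slabBall_mono (hs : s ≤ s₂) (hr : r ≤ r₂) : slabBall θ s r ⊆ slabBall θ s₂ r₂ :=
  fun _ hv => ⟨hv.1.trans hs, hv.2.trans hr⟩

theorem volume_slabBall_pos (hs : 0 < s) (hr : 0 < r) : 0 < volume (slabBall θ s r) := by
  have hopen : IsOpen {v : EuclideanSpace ℝ (Fin d) | |⟪θ, v⟫| < s ∧ ‖v‖ < r} :=
    IsOpen.and (isOpen_lt (f := fun v => |⟪θ, v⟫|) (by fun_prop) continuous_const)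
      (isOpen_lt (f := fun v => ‖v‖) (by fun_prop) continuous_const)
  exact (hopen.measure_pos volume ⟨0, by simp [hs, hr]⟩).trans_le
    (measure_mono fun v hv => ⟨hv.1.le, hv.2.le⟩)

theorem volume_slabBall_lt_top : volume (slabBall θ s r) < ⊤ :=
  (measure_mono (t := Metric.closedBall 0 r) fun v (hv : v ∈ slabBall θ s r) => by
    simpa using hv.2).trans_lt measure_closedBall_lt_top

theorem volume_slabBall_two_mul :
    volume (slabBall θ (2 * s) (2 * r)) = 2 ^ d * volume (slabBall θ s r) := by
  have : slabBall θ s r = (fun v => (2 : ℝ) • v) ⁻¹' slabBall θ (2 * s) (2 * r) := by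
    ext v
    simp [slabBall, inner_smul_right, abs_mul, norm_smul]
  rw [this, Measure.addHaar_preimage_smul volume two_ne_zero, ← mul_assoc]
  have h2 : (2 : ℝ≥0∞) ^ d * ENNReal.ofReal |((2 : ℝ) ^ Module.finrank ℝ
      (EuclideanSpace ℝ (Fin d)))⁻¹| = 1 := by
    rw [abs_of_nonneg (by positivity), ENNReal.ofReal_inv_of_pos (by positivity),
      ENNReal.ofReal_pow (by norm_num)]
    simp only [finrank_euclideanSpace, Fintype.card_fin, ENNReal.ofReal_ofNat]
    exact ENNReal.mul_inv_cancel (by positivity) (by finiteness)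
  rw [h2, one_mul]

theorem volume_sub_mem_slabBall (p : EuclideanSpace ℝ (Fin d)) :
    volume {z | p - z ∈ slabBall θ s r} = volume (slabBall θ s r) :=
  (volume.measurePreserving_sub_left p).measure_preimage
    isClosed_slabBall.measurableSet.nullMeasurableSet

theorem measurableSet_sub_mem_slabBall (p : EuclideanSpace ℝ (Fin d)) :
    MeasurableSet {z | p - z ∈ slabBall θ s r} :=
  (isClosed_slabBall.preimage (continuous_const.sub continuous_id)).measurableSet

open Classical in
-- Two points whose slabs share a `z` differ by an element of the doubled slab, and the common shift
-- `a` cancels. The bound is thus independent of `a`.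
theorem lintegral_sq_sum_indicator_le (P : Finset (EuclideanSpace ℝ (Fin d)))
    (a : EuclideanSpace ℝ (Fin d)) :
    ∫⁻ z, (∑ p ∈ P, {z | p + a - z ∈ slabBall θ s r}.indicator (1 : EuclideanSpace ℝ (Fin d) → ℝ≥0∞) z) *
        (∑ p ∈ P, {z | p + a - z ∈ slabBall θ s r}.indicator (1 : EuclideanSpace ℝ (Fin d) → ℝ≥0∞) z) ≤
      ((P ×ˢ P).filter fun z => z.1 - z.2 ∈ slabBall θ (2 * s) (2 * r)).card *
        volume (slabBall θ s r) := by
  have hm : ∀ p : EuclideanSpace ℝ (Fin d), Measurable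
      ({z | p + a - z ∈ slabBall θ s r}.indicator (1 : EuclideanSpace ℝ (Fin d) → ℝ≥0∞)) := fun p =>
    measurable_one.indicator (measurableSet_sub_mem_slabBall _)
  simp_rw [Finset.sum_mul_sum, ← Finset.sum_product']
  rw [lintegral_finsetSum _ fun z _ => (hm z.1).mul (hm z.2), Finset.card_filter,
    Nat.cast_sum, Finset.sum_mul]
  refine Finset.sum_le_sum fun z _ => ?_
  split_ifs with hz
  · rw [Nat.cast_one, one_mul, ← volume_sub_mem_slabBall (z.1 + a),
      ← lintegral_indicator_one (measurableSet_sub_mem_slabBall _)]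
    refine lintegral_mono fun x => ?_
    refine mul_le_of_le_one_right' ?_
    exact indicator_le_self' (fun _ _ => zero_le) x
  · rw [Nat.cast_zero, zero_mul, nonpos_iff_eq_zero]
    refine lintegral_eq_zero_of_ae_eq_zero (Filter.Eventually.of_forall fun x => ?_)
    by_cases h1 : z.1 + a - x ∈ slabBall θ s r
    · by_cases h2 : z.2 + a - x ∈ slabBall θ s r
      · refine absurd ?_ hz
        have := sub_mem_slabBall h1 h2
        rw [two_mul, two_mul]
        convert this using 1
        abel
      · simp [h2]
    · simp [h1]

open Classical in
/-- Pairs whose difference lies in a translate of a slab are controlled by pairs whose difference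
lies in a dilate of the slab itself. -/
theorem card_sub_sub_mem_slabBall_le (P : Finset (EuclideanSpace ℝ (Fin d)))
    (a : EuclideanSpace ℝ (Fin d)) (hs : 0 < s) (hr : 0 < r) :
    ((P ×ˢ P).filter fun z => z.1 - z.2 - a ∈ slabBall θ s r).card ≤
      2 ^ (d + 1) * ((P ×ˢ P).filter fun z => z.1 - z.2 ∈ slabBall θ (4 * s) (4 * r)).card := by
  set N := (P ×ˢ P).filter fun z => z.1 - z.2 - a ∈ slabBall θ s r with hN
  -- `g b z` counts the points of `P + b` in a doubled slab around `z`. Doubling ensures that `p₁ -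
  -- z ∈ S` and `p₁ - p₂ - a ∈ S` force `p₂ + a` to be counted. Then `g₀ gₐ ≤ g₀² + gₐ²` reduces the
  -- correlation to two autocorrelations, whence one factor 2; the volume of the doubled slab gives
  -- `2 ^ d`.
  set g : EuclideanSpace ℝ (Fin d) → EuclideanSpace ℝ (Fin d) → ℝ≥0∞ := fun b z =>
    ∑ p ∈ P, {z | p + b - z ∈ slabBall θ (2 * s) (2 * r)}.indicator (1 : EuclideanSpace ℝ (Fin d) → ℝ≥0∞) z with hg
  have hgm : ∀ b, Measurable (g b) := fun b => Finset.measurable_fun_sum _ fun p _ =>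
    measurable_one.indicator (measurableSet_sub_mem_slabBall _)
  have hlow : (N.card : ℝ≥0∞) * volume (slabBall θ s r) ≤ ∫⁻ z, g 0 z * g a z := by
    have e : (N.card : ℝ≥0∞) * volume (slabBall θ s r) =
        ∫⁻ z, ∑ p ∈ N, {z | p.1 - z ∈ slabBall θ s r}.indicator (1 : EuclideanSpace ℝ (Fin d) → ℝ≥0∞) z := by
      rw [lintegral_finsetSum _ fun p _ =>
        measurable_one.indicator (measurableSet_sub_mem_slabBall _)]
      simp_rw [lintegral_indicator_one (measurableSet_sub_mem_slabBall _),
        volume_sub_mem_slabBall, Finset.sum_const, nsmul_eq_mul]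
    rw [e]
    refine lintegral_mono fun z => ?_
    have hprod : g 0 z * g a z = ∑ p ∈ P ×ˢ P,
        {z | p.1 + 0 - z ∈ slabBall θ (2 * s) (2 * r)}.indicator
          (1 : EuclideanSpace ℝ (Fin d) → ℝ≥0∞) z *
        {z | p.2 + a - z ∈ slabBall θ (2 * s) (2 * r)}.indicator
          (1 : EuclideanSpace ℝ (Fin d) → ℝ≥0∞) z := by
      rw [hg, Finset.sum_mul_sum, Finset.sum_product]
    rw [hprod, hN, Finset.sum_filter]
    refine Finset.sum_le_sum fun p _ => ?_
    split_ifs with hp'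
    swap
    · exact zero_le
    by_cases h1 : p.1 - z ∈ slabBall θ s r
    · have h2 : p.1 + 0 - z ∈ slabBall θ (2 * s) (2 * r) := by
        rw [add_zero]
        exact slabBall_mono (by linarith) (by linarith) h1
      have h3 : p.2 + a - z ∈ slabBall θ (2 * s) (2 * r) := by
        have := sub_mem_slabBall h1 hp'
        rw [two_mul, two_mul]
        convert this using 1
        abel
      rw [indicator_of_mem (show z ∈ {z | p.1 + 0 - z ∈ slabBall θ (2 * s) (2 * r)} from h2),
        indicator_of_mem (show z ∈ {z | p.2 + a - z ∈ slabBall θ (2 * s) (2 * r)} from h3)]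
      simp only [Pi.one_apply, mul_one]
      exact indicator_le_self' (fun _ _ => zero_le) z
    · rw [indicator_of_notMem (show z ∉ {z | p.1 - z ∈ slabBall θ s r} from h1)]
      exact zero_le
  have hup : ∫⁻ z, g 0 z * g a z ≤ ∫⁻ z, (g 0 z * g 0 z + g a z * g a z) := by
    refine lintegral_mono fun z => ?_
    rcases le_total (g 0 z) (g a z) with h | h
    · exact (mul_le_mul_left h _).trans le_add_self
    · exact (mul_le_mul_right h _).trans le_self_add
  rw [lintegral_add_left (f := fun z => g 0 z * g 0 z) ((hgm 0).mul (hgm 0))] at hup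
  have hsq := add_le_add (lintegral_sq_sum_indicator_le (θ := θ) (s := 2 * s) (r := 2 * r) P 0)
    (lintegral_sq_sum_indicator_le (θ := θ) (s := 2 * s) (r := 2 * r) P a)
  have hfin := hlow.trans (hup.trans hsq)
  rw [volume_slabBall_two_mul, ← two_mul, show 2 * (2 * s) = 4 * s by ring,
    show 2 * (2 * r) = 4 * r by ring, ← mul_assoc, ← mul_assoc,
    ENNReal.mul_le_mul_iff_left (volume_slabBall_pos hs hr).ne' volume_slabBall_lt_top.ne] at hfin
  have : (N.card : ℝ≥0∞) ≤ ((2 ^ (d + 1) * ((P ×ˢ P).filter fun z =>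
      z.1 - z.2 ∈ slabBall θ (4 * s) (4 * r)).card : ℕ) : ℝ≥0∞) := by
    refine hfin.trans (le_of_eq ?_)
    push_cast
    ring
  exact_mod_cast this

end Shift

/-! ### Slab cover of the shell and the double count. -/

namespace IsSmoothCurvedSymmetricBody

open MeasureTheory Set
open scoped RealInnerProductSpace

variable {d : ℕ} {B : Set (EuclideanSpace ℝ (Fin d))}

theorem exists_unit_support (hB : IsSmoothCurvedSymmetricBody B)
    {y : EuclideanSpace ℝ (Fin d)} (hy : y ∈ frontier B) :
    ∃ e : EuclideanSpace ℝ (Fin d), ‖e‖ = 1 ∧ ∀ z ∈ closure B, ⟪e, z⟫ ≤ ⟪e, y⟫ := by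
  obtain ⟨f, hf⟩ := geometric_hahn_banach_open_point hB.convex.interior isOpen_interior hy.2
  set v := (InnerProductSpace.toDual ℝ (EuclideanSpace ℝ (Fin d))).symm f with hv
  have hfv : ∀ z, ⟪v, z⟫ = f z := fun z => by
    rw [hv, InnerProductSpace.toDual_symm_apply]
  have hv0 : v ≠ 0 := by
    intro h0
    have := hf 0 hB.zero_mem_interior
    rw [← hfv, ← hfv, h0] at this
    simp at this
  have hn : 0 < ‖v‖ := norm_pos_iff.2 hv0
  refine ⟨‖v‖⁻¹ • v, by rw [norm_smul, norm_inv, norm_norm, inv_mul_cancel₀ hn.ne'], ?_⟩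
  intro z hz
  rw [← hB.convex.closure_interior_eq_closure_of_nonempty_interior hB.interior_nonempty] at hz
  simp only [inner_smul_left, conj_trivial, hfv]
  refine mul_le_mul_of_nonneg_left ?_ (by positivity)
  exact closure_minimal (fun w hw => (hf w hw).le) (isClosed_le f.continuous continuous_const) hz

/-- The vectors of `B`-norm in `[k, k + kε²]` are covered by slabs of dimensions `kε` and `kε²`
around multiples of support points, the slab at a given vector being available for a box of normals
of volume comparable to `ε ^ (d - 1)`. -/
theorem exists_slab_cover (hd : 0 < d) (hB : IsSmoothCurvedSymmetricBody B) :
    ∃ (u : EuclideanSpace ℝ (Fin d) → EuclideanSpace ℝ (Fin d)) (C M : ℝ), 0 < C ∧ 0 < M ∧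
      ∀ k ε : ℝ, 1 < k → 0 < ε → k * ε ^ 2 ≤ 1 → ∀ x : EuclideanSpace ℝ (Fin d),
        k ≤ gauge B x → gauge B x ≤ k + k * ε ^ 2 →
        ∃ G : Set (EuclideanSpace ℝ (Fin d)), MeasurableSet G ∧
          volume G = ENNReal.ofReal ((2 * ε) ^ (d - 1)) ∧
          ∀ θ ∈ G, ‖θ‖ ≤ M ∧ x - k • u θ ∈ slabBall θ (C * (k * ε ^ 2)) (C * (k * ε)) := by
  obtain ⟨κ, hκ, hconv⟩ := hB.exists_forall_le_inner_sub
  have hmax : ∀ θ : EuclideanSpace ℝ (Fin d), ∃ z ∈ closure B, ∀ y ∈ closure B,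
      ⟪θ, y⟫ ≤ ⟪θ, z⟫ := fun θ =>
    hB.isCompact_closure.exists_isMaxOn ⟨0, subset_closure (interior_subset hB.zero_mem_interior)⟩
      (f := fun y => ⟪θ, y⟫) (by fun_prop)
  choose u hu hmaxu using hmax
  obtain ⟨D, hD0, hD⟩ := hB.isCompact_closure.isBounded.exists_pos_norm_le
  have hdR : (0 : ℝ) < d := by exact_mod_cast hd
  refine ⟨u, (2 + d) * D + d ^ 2 / κ + (D + d / κ), 2 + d, by positivity, by positivity, ?_⟩
  intro k ε hk hε hkε x hx1 hx2
  have hε1 : ε ≤ 1 := by nlinarith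
  have hnhds : B ∈ nhds 0 := mem_interior_iff_mem_nhds.1 hB.zero_mem_interior
  set s := gauge B x with hs
  have hs0 : 0 < s := by linarith
  set y := s⁻¹ • x with hy
  have hxy : x = s • y := by rw [hy, smul_smul, mul_inv_cancel₀ hs0.ne', one_smul]
  have hyfr : y ∈ frontier B := by
    rw [← gauge_eq_one_iff_mem_frontier hB.convex hnhds, hy,
      gauge_smul_of_nonneg (by positivity), smul_eq_mul, ← hs, inv_mul_cancel₀ hs0.ne']
  clear_value y
  obtain ⟨e, he, hesupp⟩ := hB.exists_unit_support hyfr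
  obtain ⟨b, hb⟩ := exists_orthonormalBasis_apply_eq (⟨0, hd⟩ : Fin d) he
  -- The box has coordinate in `[1, 2]` along the unit normal `e` at `y` and transverse coordinates
  -- of size at most `ε`. Its directions thus lie within `O(ε)` of `e`, while its volume loses only
  -- `d - 1` powers of `ε`.
  refine ⟨_, measurableSet_box b ⟨0, hd⟩ 1 2 ε, ?_, ?_⟩
  · rw [volume_box, ENNReal.ofReal_pow (by positivity)]
    norm_num
  rintro θ ⟨⟨ht1, ht2⟩, hθ⟩
  rw [hb] at ht1 ht2
  set t := ⟪e, θ⟫ with ht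
  have hg : ‖θ - t • e‖ ≤ d * ε := by
    refine le_of_sq_le_sq ?_ (by positivity)
    rw [← b.sum_sq_norm_inner_right]
    calc _ ≤ ∑ i : Fin d, ε ^ 2 := by
          refine Finset.sum_le_sum fun i _ => ?_
          rw [Real.norm_eq_abs, sq_abs, sq_le_sq, abs_of_pos hε, ← hb, inner_sub_right,
            inner_smul_right]
          by_cases hi : i = ⟨0, hd⟩
          · rw [hi, real_inner_self_eq_norm_sq, b.norm_eq_one, ht, hb]
            simp [hε.le]
          · rw [b.inner_eq_zero hi]
            simpa using hθ i hi
      _ = d * ε ^ 2 := by simp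
      _ ≤ (d * ε) ^ 2 := by
          have : (1 : ℝ) ≤ d := by exact_mod_cast hd
          rw [mul_pow]
          gcongr
          nlinarith
  have hte : ‖t • e‖ = t := by rw [norm_smul, he, mul_one, Real.norm_of_nonneg (by linarith)]
  have hθn : ‖θ‖ ≤ 2 + d := by
    have := norm_le_norm_add_norm_sub' θ (t • e)
    nlinarith
  refine ⟨hθn, ?_⟩
  set z := u θ with hz
  have hyB : y ∈ closure B := hyfr.1
  have hc1 := hconv θ z (hu θ) (hmaxu θ) y hyB
  have hc2 := hconv (t • e) y hyB (fun w hw => by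
    simp only [inner_smul_left, conj_trivial]
    exact mul_le_mul_of_nonneg_left (hesupp w hw) (by linarith)) z (hu θ)
  rw [hte, norm_sub_rev] at hc2
  -- `z` is extremal for `θ` and `y` for `t • e`. Adding the two strong convexity inequalities
  -- bounds `‖z - y‖²` by `‖θ - t • e‖ ‖z - y‖`, so the support point moves by `O(ε)`. Its height
  -- defect `⟪θ, z - y⟫` is then `O(ε²)`.
  have hsum : ⟪θ, z - y⟫ + ⟪t • e, y - z⟫ = ⟪θ - t • e, z - y⟫ := by
    rw [inner_sub_left, ← neg_sub z y, inner_neg_right]; ring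
  have hcs := real_inner_le_norm (θ - t • e) (z - y)
  have hzy : ‖z - y‖ ≤ d / κ * ε := by
    have h1 : κ * ‖z - y‖ ^ 2 ≤ d * ε * ‖z - y‖ := by
      have h2 : 0 ≤ κ * ‖θ‖ * ‖z - y‖ ^ 2 := by positivity
      have h3 : κ * 1 * ‖z - y‖ ^ 2 ≤ κ * t * ‖z - y‖ ^ 2 := by gcongr
      have h4 := mul_le_mul_of_nonneg_right hg (norm_nonneg (z - y))
      linarith
    rcases (norm_nonneg (z - y)).eq_or_lt with h0 | h0
    · rw [← h0]; positivity
    · rw [div_mul_eq_mul_div, le_div_iff₀ hκ]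
      refine le_of_mul_le_mul_right ?_ h0
      linarith
  have hin0 : 0 ≤ ⟪θ, z - y⟫ := le_trans (by positivity) hc1
  have hin1 : ⟪θ, z - y⟫ ≤ d ^ 2 / κ * ε ^ 2 := by
    have h2 : 0 ≤ κ * t * ‖z - y‖ ^ 2 := by positivity
    have h3 : ‖θ - t • e‖ * ‖z - y‖ ≤ (d * ε) * (d / κ * ε) := by gcongr
    have h4 : (d * ε) * (d / κ * ε) = d ^ 2 / κ * ε ^ 2 := by ring
    linarith
  have hdecomp : x - k • z = (s - k) • y - k • (z - y) := by
    rw [hxy]; module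
  have hsk : 0 ≤ s - k := by linarith
  have hsk' : s - k ≤ k * ε ^ 2 := by linarith
  have hyD : ‖y‖ ≤ D := hD y hyB
  have hk0 : 0 < k := by linarith
  have hθy : |⟪θ, y⟫| ≤ (2 + d) * D :=
    (abs_real_inner_le_norm _ _).trans (by gcongr)
  constructor
  · rw [hdecomp, inner_sub_right, inner_smul_right, inner_smul_right]
    calc _ ≤ |(s - k) * ⟪θ, y⟫| + |k * ⟪θ, z - y⟫| := abs_sub _ _
      _ = (s - k) * |⟪θ, y⟫| + k * ⟪θ, z - y⟫ := by
          rw [abs_mul, abs_of_nonneg hsk, abs_of_nonneg (mul_nonneg hk0.le hin0)]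
      _ ≤ (k * ε ^ 2) * ((2 + d) * D) + k * (d ^ 2 / κ * ε ^ 2) := by gcongr
      _ = ((2 + d) * D + d ^ 2 / κ + 0) * (k * ε ^ 2) := by ring
      _ ≤ ((2 + d) * D + d ^ 2 / κ + (D + d / κ)) * (k * ε ^ 2) := by gcongr; positivity
  · rw [hdecomp]
    calc _ ≤ ‖(s - k) • y‖ + ‖k • (z - y)‖ := norm_sub_le _ _
      _ = (s - k) * ‖y‖ + k * ‖z - y‖ := by
          rw [norm_smul, norm_smul, Real.norm_of_nonneg hsk, Real.norm_of_nonneg hk0.le]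
      _ ≤ (k * ε ^ 2) * D + k * (d / κ * ε) := by gcongr
      _ ≤ (k * ε) * D + k * (d / κ * ε) := by gcongr; nlinarith
      _ = (0 + (D + d / κ)) * (k * ε) := by ring
      _ ≤ ((2 + d) * D + d ^ 2 / κ + (D + d / κ)) * (k * ε) := by gcongr; positivity

open scoped ENNReal

open Classical in
-- Each diagonal pair contributes at most the volume of a ball. An off-diagonal pair contributes
-- `O(s / |p - q|)` if `|p - q| ≤ r` and nothing otherwise; the packing bound sums these.
theorem sum_volume_slab_le (hd : 2 ≤ d) {c : ℝ} (hc : 0 < c)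
    {P : Finset (EuclideanSpace ℝ (Fin d))}
    (hsep : ∀ p ∈ P, ∀ p' ∈ P, p ≠ p' → c ≤ dist p p') {M s r : ℝ} (hM : 0 < M) (hs : 0 < s)
    (hr : 0 < r) :
    ∑ z ∈ P ×ˢ P, volume {θ : EuclideanSpace ℝ (Fin d) | ‖θ‖ ≤ M ∧ z.1 - z.2 ∈ slabBall θ s r} ≤
      ENNReal.ofReal (P.card * (volume.real (Metric.closedBall (0 : EuclideanSpace ℝ (Fin d)) M) +
        8 * (2 * M) ^ (d - 1) * (3 / c) ^ d * (s * r ^ (d - 1)))) := by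
  have hterm : ∀ p ∈ P, ∀ q ∈ P,
      volume {θ : EuclideanSpace ℝ (Fin d) | ‖θ‖ ≤ M ∧ p - q ∈ slabBall θ s r} ≤
        ENNReal.ofReal ((if q = p then
          volume.real (Metric.closedBall (0 : EuclideanSpace ℝ (Fin d)) M) else 0) +
          2 * s * (2 * M) ^ (d - 1) * (if q ≠ p ∧ dist p q ≤ r then (dist p q)⁻¹ else 0)) := by
    intro p hp q hq
    by_cases hqp : q = p
    · simp only [hqp, if_true, ne_eq, not_true, false_and, if_false, mul_zero, add_zero]
      rw [measureReal_def, ENNReal.ofReal_toReal measure_closedBall_lt_top.ne]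
      exact measure_mono fun θ hθ => by simpa using hθ.1
    · rw [if_neg hqp, zero_add]
      by_cases hle : dist p q ≤ r
      · rw [if_pos ⟨hqp, hle⟩]
        refine (measure_mono (t := {θ | ‖θ‖ ≤ M ∧ |⟪θ, p - q⟫| ≤ s})
          fun θ hθ => ⟨hθ.1, hθ.2.1⟩).trans
          ((volume_ball_inter_slab_le (by omega) (sub_ne_zero.2 (Ne.symm hqp)) M s).trans
            (le_of_eq ?_))
        rw [← ENNReal.ofReal_pow (by positivity), ← ENNReal.ofReal_mul (by positivity),
          dist_eq_norm]
        congr 1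
        ring
      · rw [if_neg fun h => hle h.2]
        have : {θ : EuclideanSpace ℝ (Fin d) | ‖θ‖ ≤ M ∧ p - q ∈ slabBall θ s r} = ∅ := by
          refine eq_empty_of_forall_notMem fun θ hθ => hle ?_
          rw [dist_eq_norm]
          exact hθ.2.2
        rw [this, measure_empty]
        exact zero_le
  have hnn : ∀ p q : EuclideanSpace ℝ (Fin d), 0 ≤ (if q = p then
          volume.real (Metric.closedBall (0 : EuclideanSpace ℝ (Fin d)) M) else 0) +
          2 * s * (2 * M) ^ (d - 1) * (if q ≠ p ∧ dist p q ≤ r then (dist p q)⁻¹ else 0) := by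
    intro p q
    split_ifs <;> positivity
  rw [Finset.sum_product]
  refine (Finset.sum_le_sum fun p hp => Finset.sum_le_sum fun q hq => hterm p hp q hq).trans ?_
  simp_rw [← ENNReal.ofReal_sum_of_nonneg fun q _ => hnn _ q]
  rw [← ENNReal.ofReal_sum_of_nonneg fun p _ => Finset.sum_nonneg fun q _ => hnn p q]
  refine ENNReal.ofReal_le_ofReal ?_
  rw [← nsmul_eq_mul]
  refine Finset.sum_le_card_nsmul _ _ _ fun p hp => ?_
  rw [Finset.sum_add_distrib, ← Finset.mul_sum, Finset.sum_ite_eq' P p, if_pos hp,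
    ← Finset.sum_filter]
  have h1 := sum_inv_dist_le hd hc hsep hp hr
  have h2 := mul_le_mul_of_nonneg_left h1 (by positivity : 0 ≤ 2 * s * (2 * M) ^ (d - 1))
  refine (add_le_add le_rfl h2).trans (le_of_eq ?_)
  ring

open Classical in
theorem exists_card_annulus_le (hd : 2 ≤ d) (hB : IsSmoothCurvedSymmetricBody B) {c : ℝ}
    (hc : 0 < c) :
    ∃ K : ℝ, 0 < K ∧ ∀ P : Finset (EuclideanSpace ℝ (Fin d)),
      (∀ p ∈ P, ∀ p' ∈ P, p ≠ p' → c ≤ dist p p') → ∀ k ε : ℝ, 1 < k → 0 < ε → k * ε ^ 2 ≤ 1 →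
        (((P ×ˢ P).filter fun z => k ≤ gauge B (z.1 - z.2) ∧
          gauge B (z.1 - z.2) ≤ k + k * ε ^ 2).card : ℝ) * ε ^ (d - 1) ≤
            K * P.card * (1 + k * ε ^ 2 * (k * ε) ^ (d - 1)) := by
  obtain ⟨u, C, M, hC, hM, hcover⟩ := hB.exists_slab_cover (by omega)
  set V := volume.real (Metric.closedBall (0 : EuclideanSpace ℝ (Fin d)) M) with hV
  set A := 8 * (2 * M) ^ (d - 1) * (3 / c) ^ d with hA
  refine ⟨2 ^ (d + 1) * (V + A * (4 * C) ^ d), by positivity, ?_⟩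
  intro P hsep k ε hk hε hkε
  have hk0 : 0 < k := by linarith
  set N := (P ×ˢ P).filter fun z => k ≤ gauge B (z.1 - z.2) ∧
          gauge B (z.1 - z.2) ≤ k + k * ε ^ 2 with hN
  have hG := fun z : EuclideanSpace ℝ (Fin d) × EuclideanSpace ℝ (Fin d) =>
    fun hz : z ∈ N => hcover k ε hk hε hkε (z.1 - z.2) (Finset.mem_filter.1 hz).2.1
      (Finset.mem_filter.1 hz).2.2
  choose! G hGm hGv hGθ using hG
  set s := C * (k * ε ^ 2) with hs
  set r := C * (k * ε) with hr
  have hs0 : 0 < s := by positivity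
  have hr0 : 0 < r := by positivity
  have hmeas : ∀ z : EuclideanSpace ℝ (Fin d) × EuclideanSpace ℝ (Fin d),
      MeasurableSet {θ : EuclideanSpace ℝ (Fin d) | ‖θ‖ ≤ M ∧
        z.1 - z.2 ∈ slabBall θ (4 * s) (4 * r)} := by
    intro z
    refine IsClosed.measurableSet (IsClosed.and
      (isClosed_le (f := fun θ => ‖θ‖) (by fun_prop) continuous_const) (IsClosed.and
      (isClosed_le (f := fun θ => |⟪θ, z.1 - z.2⟫|) (by fun_prop) continuous_const)
      isClosed_const))
  have hlow : (N.card : ℝ≥0∞) * ENNReal.ofReal ((2 * ε) ^ (d - 1)) =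
      ∫⁻ θ, ∑ z ∈ N, (G z).indicator (1 : EuclideanSpace ℝ (Fin d) → ℝ≥0∞) θ := by
    rw [lintegral_finsetSum _ fun z hz => measurable_one.indicator (hGm z hz),
      ← nsmul_eq_mul, ← Finset.sum_const]
    refine Finset.sum_congr rfl fun z hz => ?_
    rw [lintegral_indicator_one (hGm z hz), hGv z hz]
  -- For fixed `θ` all pairs tagged by it have difference in the same translate `k • u θ + S_θ`,
  -- because `u θ` does not depend on the pair. The translation can therefore be removed for all of
  -- them at once.
  have hmid : ∀ θ, ∑ z ∈ N, (G z).indicator (1 : EuclideanSpace ℝ (Fin d) → ℝ≥0∞) θ ≤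
      2 ^ (d + 1) * ∑ z ∈ P ×ˢ P, {θ : EuclideanSpace ℝ (Fin d) | ‖θ‖ ≤ M ∧
        z.1 - z.2 ∈ slabBall θ (4 * s) (4 * r)}.indicator
          (1 : EuclideanSpace ℝ (Fin d) → ℝ≥0∞) θ := by
    intro θ
    by_cases hθ : ‖θ‖ ≤ M
    · have h1 : ∑ z ∈ N, (G z).indicator (1 : EuclideanSpace ℝ (Fin d) → ℝ≥0∞) θ ≤
          ((P ×ˢ P).filter fun z => z.1 - z.2 - k • u θ ∈ slabBall θ s r).card := by
        rw [Finset.card_filter, Nat.cast_sum, hN, Finset.sum_filter]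
        refine Finset.sum_le_sum fun z hz => ?_
        split_ifs with h2 h3 h3
        · rw [Nat.cast_one]
          exact indicator_le_self' (fun _ _ => zero_le) θ
        · rw [indicator_of_notMem]
          · exact zero_le
          · exact fun h4 => h3 (hGθ z (Finset.mem_filter.2 ⟨hz, h2⟩) θ h4).2
        · exact zero_le
        · exact zero_le
      have h2 : (((P ×ˢ P).filter fun z => z.1 - z.2 - k • u θ ∈ slabBall θ s r).card : ℝ≥0∞) ≤
          2 ^ (d + 1) * ((P ×ˢ P).filter fun z =>
            z.1 - z.2 ∈ slabBall θ (4 * s) (4 * r)).card := by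
        exact_mod_cast card_sub_sub_mem_slabBall_le P (k • u θ) hs0 hr0
      refine (h1.trans h2).trans (le_of_eq ?_)
      congr 1
      rw [Finset.card_filter, Nat.cast_sum]
      refine Finset.sum_congr rfl fun z _ => ?_
      simp [indicator_apply, hθ]
    · rw [Finset.sum_eq_zero]
      · exact zero_le
      · intro z hz
        exact indicator_of_notMem (fun h => hθ (hGθ z hz θ h).1) _
  have hup : (N.card : ℝ≥0∞) * ENNReal.ofReal ((2 * ε) ^ (d - 1)) ≤ 2 ^ (d + 1) *
      ENNReal.ofReal (P.card * (V + A * (4 * s * (4 * r) ^ (d - 1)))) := by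
    rw [hlow]
    refine (lintegral_mono hmid).trans ?_
    rw [lintegral_const_mul' _ _ (by finiteness),
      lintegral_finsetSum _ fun z _ => measurable_one.indicator (hmeas z)]
    refine mul_le_mul_right ?_ _
    simp_rw [lintegral_indicator_one (hmeas _)]
    exact sum_volume_slab_le hd hc hsep hM (by positivity) (by positivity)
  rw [← ENNReal.ofReal_natCast, ← ENNReal.ofReal_mul (by positivity),
    show (2 : ℝ≥0∞) ^ (d + 1) = ENNReal.ofReal (2 ^ (d + 1)) by
      rw [ENNReal.ofReal_pow (by norm_num)]; simp,
    ← ENNReal.ofReal_mul (by positivity), ENNReal.ofReal_le_ofReal_iff (by positivity)] at hup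
  have hpow : 4 * s * (4 * r) ^ (d - 1) = (4 * C) ^ d * (k * ε ^ 2 * (k * ε) ^ (d - 1)) := by
    obtain ⟨j, rfl⟩ : ∃ j, d = j + 1 := ⟨d - 1, by omega⟩
    rw [hs, hr, Nat.add_sub_cancel, pow_succ (4 * C), ← mul_assoc 4 C (k * ε),
      mul_pow (4 * C) (k * ε)]
    ring
  set X := k * ε ^ 2 * (k * ε) ^ (d - 1) with hX
  have hX0 : 0 ≤ X := by positivity
  rw [hpow] at hup
  calc (N.card : ℝ) * ε ^ (d - 1) ≤ N.card * (2 * ε) ^ (d - 1) := by gcongr; linarith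
    _ ≤ 2 ^ (d + 1) * (P.card * (V + A * ((4 * C) ^ d * X))) := hup
    _ ≤ 2 ^ (d + 1) * (P.card * ((V + A * (4 * C) ^ d) * (1 + X))) := by
        have : V + A * ((4 * C) ^ d * X) ≤ (V + A * (4 * C) ^ d) * (1 + X) := by
          have h1 : 0 ≤ V * X := by positivity
          have h2 : 0 ≤ A * (4 * C) ^ d := by positivity
          nlinarith
        gcongr
    _ = _ := by ring

end IsSmoothCurvedSymmetricBody

/-! ### Choice of the angular scale and the final exponents. -/

theorem distancePairCount_eq_card_filter {d : ℕ} (B : Set (EuclideanSpace ℝ (Fin d))) (n : ℕ)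
    (P : Finset (EuclideanSpace ℝ (Fin d))) (k : ℝ)
    [DecidablePred fun z : EuclideanSpace ℝ (Fin d) × EuclideanSpace ℝ (Fin d) =>
      k ≤ gauge B (z.1 - z.2) ∧ gauge B (z.1 - z.2) ≤
        k + (n : ℝ) ^ (-(((d : ℝ) - 1) / ((d : ℝ) * ((d : ℝ) + 1))))] :
    distancePairCount B n P k = ((P ×ˢ P).filter fun z => k ≤ gauge B (z.1 - z.2) ∧
      gauge B (z.1 - z.2) ≤
        k + (n : ℝ) ^ (-(((d : ℝ) - 1) / ((d : ℝ) * ((d : ℝ) + 1))))).card := by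
  rw [distancePairCount, ← Set.ncard_coe_finset]
  congr 1
  ext z
  simp [and_assoc]

open Classical in
theorem IsSmoothCurvedSymmetricBody.exists_distancePairCount_le {d : ℕ} (hd : 2 ≤ d)
    {B : Set (EuclideanSpace ℝ (Fin d))} (hB : IsSmoothCurvedSymmetricBody B) {c : ℝ}
    (hc : 0 < c) :
    ∃ C : ℝ, 0 < C ∧ ∀ (n : ℕ) (P : Finset (EuclideanSpace ℝ (Fin d))),
      IsWellDistributed c n P → ∀ k : ℝ, 1 < k → k < (n : ℝ) ^ (1 / (d : ℝ)) →
        (distancePairCount B n P k : ℝ) ≤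
          C * (n : ℝ) ^ (2 - 2 / ((d : ℝ) + 1)) *
            (k / (n : ℝ) ^ (1 / (d : ℝ))) ^ (((d : ℝ) - 1) / 2) := by
  obtain ⟨K, hK, hbound⟩ := hB.exists_card_annulus_le hd hc
  refine ⟨2 * K, by positivity, fun n P hP k hk hkn => ?_⟩
  have hdR : (2 : ℝ) ≤ d := by exact_mod_cast hd
  have hd0 : (d : ℝ) ≠ 0 := by linarith
  have hk0 : 0 < k := by linarith
  have hn0 : n ≠ 0 := by
    rintro rfl
    rw [Nat.cast_zero, Real.zero_rpow (one_div_ne_zero hd0)] at hkn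
    linarith
  have hn1 : (1 : ℝ) ≤ n := by exact_mod_cast Nat.one_le_iff_ne_zero.2 hn0
  have hn : (0 : ℝ) < n := by linarith
  rw [distancePairCount_eq_card_filter]
  set b := ((d : ℝ) - 1) / ((d : ℝ) * ((d : ℝ) + 1)) with hb
  have hb0 : 0 ≤ b := div_nonneg (by linarith) (by positivity)
  set a := ((d : ℝ) - 1) / 2 with ha
  have ha0 : 0 ≤ a := by rw [ha]; linarith
  set τ := (n : ℝ) ^ (-b) with hτ
  have hτ0 : 0 < τ := by positivity
  have hτ1 : τ ≤ 1 := Real.rpow_le_one_of_one_le_of_nonpos hn1 (by linarith)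
  -- The scale at which the slab thickness `k ε²` equals the width `τ` of the shell.
  set ε := Real.sqrt (τ / k) with hε
  have hε0 : 0 < ε := by positivity
  have hkε : k * ε ^ 2 = τ := by
    rw [hε, Real.sq_sqrt (by positivity)]; field_simp
  have hmain := hbound P hP.separated k ε hk hε0 (hkε.trans_le hτ1)
  rw [hkε, hP.card_eq] at hmain
  have hcast : ((d - 1 : ℕ) : ℝ) = 2 * a := by
    rw [Nat.cast_sub (by omega), Nat.cast_one, ha]; ring
  have hεpow : ε ^ (d - 1) = τ ^ a * k ^ (-a) := by
    rw [hε, Real.sqrt_eq_rpow, ← Real.rpow_natCast, ← Real.rpow_mul (by positivity), hcast,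
      show 1 / 2 * (2 * a) = a by ring, Real.div_rpow hτ0.le hk0.le, Real.rpow_neg hk0.le,
      div_eq_mul_inv]
  have hkpow : k ^ (d - 1) = k ^ a * k ^ a := by
    rw [← Real.rpow_natCast, hcast, ← Real.rpow_add hk0]
    ring_nf
  set T := (n : ℝ) ^ (2 - 2 / ((d : ℝ) + 1)) * (k / (n : ℝ) ^ (1 / (d : ℝ))) ^ a with hT
  have hTeq : T = (n : ℝ) ^ (1 + b * a) * k ^ a := by
    rw [hT, Real.div_rpow hk0.le (by positivity), ← Real.rpow_mul hn.le,
      div_eq_mul_inv (k ^ a), ← Real.rpow_neg hn.le, mul_left_comm, ← Real.rpow_add hn, mul_comm]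
    congr 2
    rw [hb, ha]
    field_simp
    ring
  -- The diagonal term matches the target exactly.
  have h1 : (n : ℝ) = T * ε ^ (d - 1) := by
    rw [hTeq, hεpow, hτ, ← Real.rpow_mul hn.le]
    have e1 : (n : ℝ) ^ (1 + b * a) * (n : ℝ) ^ (-b * a) = n := by
      rw [← Real.rpow_add hn]; ring_nf; exact Real.rpow_one _
    have e2 : k ^ a * k ^ (-a) = 1 := by
      rw [← Real.rpow_add hk0]; simp
    calc (n : ℝ) = ((n : ℝ) ^ (1 + b * a) * (n : ℝ) ^ (-b * a)) * (k ^ a * k ^ (-a)) := by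
          rw [e1, e2, mul_one]
      _ = _ := by ring
  -- The identity `b (1 + a) = a / d` balances the two terms at `k = n^(1/d)`; below it, one factor
  -- `k ^ a` is bounded by `n ^ (a / d)`.
  have h2 : (n : ℝ) * τ * k ^ (d - 1) ≤ T := by
    have e1 : k ^ a ≤ (n : ℝ) ^ (a / d) := by
      calc k ^ a ≤ ((n : ℝ) ^ (1 / (d : ℝ))) ^ a := by gcongr
        _ = _ := by rw [← Real.rpow_mul hn.le]; congr 1; ring
    calc (n : ℝ) * τ * k ^ (d - 1) = (n : ℝ) ^ (1 : ℝ) * (n : ℝ) ^ (-b) * k ^ a * k ^ a := by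
          rw [hkpow, hτ, Real.rpow_one]; ring
      _ ≤ (n : ℝ) ^ (1 : ℝ) * (n : ℝ) ^ (-b) * (n : ℝ) ^ (a / d) * k ^ a := by gcongr
      _ = T := by
        rw [hTeq, ← Real.rpow_add hn, ← Real.rpow_add hn]
        congr 2
        rw [hb, ha]
        field_simp
        ring
  rw [mul_assoc, ← hT]
  refine le_of_mul_le_mul_right (hmain.trans ?_) (pow_pos hε0 (d - 1))
  calc K * n * (1 + τ * (k * ε) ^ (d - 1))
      = K * (n + n * τ * k ^ (d - 1) * ε ^ (d - 1)) := by rw [mul_pow]; ring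
    _ ≤ K * (T * ε ^ (d - 1) + T * ε ^ (d - 1)) := by gcongr; exact h1.le
    _ = 2 * K * T * ε ^ (d - 1) := by ring

theorem theorem1p2 (d : ℕ) (hd : 2 ≤ d) (B : Set (EuclideanSpace ℝ (Fin d)))
    (hB : IsSmoothCurvedSymmetricBody B) (c : ℝ) (hc : 0 < c) :
    (∃ C : ℝ, 0 < C ∧ ∀ (n : ℕ) (P : Finset (EuclideanSpace ℝ (Fin d))),
      IsWellDistributed c n P → ∀ k : ℝ, 1 < k → k < (n : ℝ) ^ (1 / (d : ℝ)) →
        (distancePairCount B n P k : ℝ) ≤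
          C * (n : ℝ) ^ (2 - 2 / ((d : ℝ) + 1)) *
            (k / (n : ℝ) ^ (1 / (d : ℝ))) ^ (((d : ℝ) - 1) / 2)) ∧
    (d = 2 → ∀ (n : ℕ → ℕ) (P : ℕ → Finset (EuclideanSpace ℝ (Fin d))) (k : ℕ → ℝ),
      (∀ j, IsWellDistributed c (n j) (P j)) →
      (∀ j, 1 < k j ∧ k j < (n j : ℝ) ^ (1 / 2 : ℝ)) →
      Asymptotics.IsLittleO Filter.atTop k (fun j => (n j : ℝ) ^ (1 / 2 : ℝ)) →
      Asymptotics.IsLittleO Filter.atTop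
        (fun j => (distancePairCount B (n j) (P j) (k j) : ℝ))
        (fun j => (n j : ℝ) ^ (4 / 3 : ℝ))) := by
  have hmain := hB.exists_distancePairCount_le hd hc
  refine ⟨hmain, ?_⟩
  rintro rfl n P k hP hk hko
  obtain ⟨C, hC, hbound⟩ := hmain
  have hle : ∀ j, (distancePairCount B (n j) (P j) (k j) : ℝ) ≤
      C * (n j : ℝ) ^ (4 / 3 : ℝ) * (k j / (n j : ℝ) ^ (1 / 2 : ℝ)) ^ (1 / 2 : ℝ) := by
    intro j
    have := hbound (n j) (P j) (hP j) (k j) (hk j).1 (by simpa using (hk j).2)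
    norm_num at this ⊢
    exact this
  have hlim : Filter.Tendsto
      (fun j => C * (k j / (n j : ℝ) ^ (1 / 2 : ℝ)) ^ (1 / 2 : ℝ)) Filter.atTop (nhds 0) := by
    have := (hko.tendsto_div_nhds_zero.rpow_const (p := 1 / 2) (Or.inr (by norm_num))).const_mul C
    simpa using this
  rw [Asymptotics.isLittleO_iff]
  intro δ hδ
  filter_upwards [hlim.eventually (gt_mem_nhds hδ)] with j hj
  rw [Real.norm_of_nonneg (Nat.cast_nonneg _), Real.norm_of_nonneg (by positivity)]
  refine (hle j).trans ?_
  rw [mul_right_comm]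
  gcongr
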